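/- A convex $3$-polytope is a bounded set $P\subset\mathbb R^3$ with nonempty interior given by an irredundant finite system of inequalities $\boldsymbol a_i\boldsymbol x+b_i\geqslant 0$, $i=1,\dots,m$; its facets are $F_i=P\cap\{\boldsymbol a_i\boldsymbol x+b_i=0\}$, its faces are the intersections of facets, and its vertices and edges are its faces of dimension $0$ and $1$. It is simple if every vertex lies in exactly $3$ facets. Let $p_k$ be the number of facets of $P$ with exactly $k$ edges. A $3$-belt of a simple $3$-polytope is a triple of facets $(F_{i},F_{j},F_{k})$ such that $F_{i}\cap F_{j}$, $F_{j}\cap F_{k}$, $F_{k}\cap F_{i}$ are edges and $F_{i}\cap F_{j}\cap F_{k}=\varnothing$. A simple polytope is flag if any nonempty set of pairwise intersecting facets has a nonempty common intersection. A fullerene is a simple $3$-polytope all of whose facets are pentagons and hexagons. Theorem. Let $P$ be a simple convex $3$-polytope with $p_3=0$, $p_4\leqslant 2$, $p_7\leqslant 1$, and $p_k=0$ for all $k\geqslant 8$. Then $P$ has no $3$-belts, and $P$ is a flag polytope. In particular, every fullerene is a flag polytope. -/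

import Mathlib

/-- The polyhedron `{x ∈ ℝⁿ : aᵢ x + bᵢ ≥ 0 for all i ∈ I}` cut out by the half-spaces with indices
in `I`. -/
def polyhedron {n m : ℕ} (a : Fin m → EuclideanSpace ℝ (Fin n)) (b : Fin m → ℝ)
    (I : Set (Fin m)) : Set (EuclideanSpace ℝ (Fin n)) :=
  {x | ∀ i ∈ I, 0 ≤ inner ℝ (a i) x + b i}

/-- A convex `n`-polytope in `ℝⁿ`: a bounded intersection of finitely many closed half-spaces, of
full dimension `n` (it has interior points), given by an irredundant system of inequalities. -/
structure ConvexPolytope (n : ℕ) where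
  /-- The number of inequalities, that is, of facets. -/
  m : ℕ
  a : Fin m → EuclideanSpace ℝ (Fin n)
  b : Fin m → ℝ
  bounded : Bornology.IsBounded (polyhedron a b Set.univ)
  full_dim : (interior (polyhedron a b Set.univ)).Nonempty
  /-- Deleting any one inequality changes the set. -/
  irredundant : ∀ i, polyhedron a b {i}ᶜ ≠ polyhedron a b Set.univ

namespace ConvexPolytope

variable {n : ℕ} (P : ConvexPolytope n)

/-- The polytope as a set of points. -/
def carrier : Set (EuclideanSpace ℝ (Fin n)) := polyhedron P.a P.b Set.univ

/-- The facet `Fᵢ`: the part of the polytope in the hyperplane `aᵢ x + bᵢ = 0`. -/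
def facet (i : Fin P.m) : Set (EuclideanSpace ℝ (Fin n)) :=
  {x ∈ P.carrier | inner ℝ (P.a i) x + P.b i = 0}

/-- A face: an intersection of facets (the polytope itself is the intersection of no facets). -/
def IsFace (F : Set (EuclideanSpace ℝ (Fin n))) : Prop :=
  ∃ S : Set (Fin P.m), F = P.carrier ∩ ⋂ i ∈ S, P.facet i

/-- A vertex: a point that is a face. -/
def IsVertex (v : EuclideanSpace ℝ (Fin n)) : Prop := P.IsFace {v}

/-- An edge: a face of dimension one. -/
def IsEdge (E : Set (EuclideanSpace ℝ (Fin n))) : Prop :=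
  P.IsFace E ∧ Module.finrank ℝ (vectorSpan ℝ E) = 1

/-- An `n`-polytope is simple if every vertex lies in exactly `n` facets. -/
def IsSimple : Prop := ∀ v, P.IsVertex v → {i | v ∈ P.facet i}.ncard = n

/-- A simple polytope is flag if any (nonempty) set of pairwise intersecting facets has a nonempty
intersection. -/
def IsFlag : Prop :=
  P.IsSimple ∧ ∀ S : Set (Fin P.m), S.Nonempty →
    (∀ i ∈ S, ∀ j ∈ S, (P.facet i ∩ P.facet j).Nonempty) → (⋂ i ∈ S, P.facet i).Nonempty

end ConvexPolytope

namespace ConvexPolytope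

variable (P : ConvexPolytope 3)

/-- The number of edges of the facet `Fᵢ` of a `3`-polytope; `Fᵢ` is a `k`-gon when it is `k`. -/
noncomputable def numEdges (i : Fin P.m) : ℕ := {E | P.IsEdge E ∧ E ⊆ P.facet i}.ncard

/-- `p_k`, the number of `k`-gonal facets. -/
noncomputable def p (k : ℕ) : ℕ := {i | P.numEdges i = k}.ncard

/-- A `k`-loop: a cyclic sequence of `k` facets whose successive members (`finRotate k` is the
cyclic successor `j ↦ j + 1 mod k`) intersect in edges. -/
def IsLoop {k : ℕ} (c : Fin k → Fin P.m) : Prop :=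
  ∀ j, P.IsEdge (P.facet (c j) ∩ P.facet (c (finRotate k j)))

/-- A `k`-belt: a `k`-loop with empty total intersection in which two members at different positions
intersect if and only if these positions are cyclically adjacent. -/
def IsBelt {k : ℕ} (c : Fin k → Fin P.m) : Prop :=
  P.IsLoop c ∧ (⋂ j, P.facet (c j)) = ∅ ∧
    ∀ p q : Fin k, p ≠ q →
      ((P.facet (c p) ∩ P.facet (c q)).Nonempty ↔ q = finRotate k p ∨ p = finRotate k q)

/-- A (combinatorial) fullerene: a simple `3`-polytope all of whose facets are pentagons and
hexagons. -/
def IsFullerene : Prop := P.IsSimple ∧ ∀ i, P.numEdges i = 5 ∨ P.numEdges i = 6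

end ConvexPolytope

/-! Suppose three facets meet pairwise but have no common vertex (`IsTriad`). A plane through an
interior point of each of their three common edges cuts P in the triangle on these points. It
contains no vertex and crosses only these three facets (`IsTriad.exists_separates`). Let s be the
total number of vertices of the three facets above the plane, counted facet by facet. Euler's
relation for the upper part (`IsSimple.card_upper_add_two`) and double counting show that the sum of
6 - k over the k-gons wholly above the plane is s - 3 (`Separates.sum_card_above`).

The facets with k < 6 above such a plane contribute more than 6 to this sum
(`Separates.six_lt_curvature`). Otherwise s ≤ 9; each of the three facets has at least 2 vertices
above, so one has exactly 2 or all have exactly 3. The facets just behind then give a new triad and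
a plane with strictly fewer facets above it; if they failed to be a triad, there would be a
triangle, respectively three quadrangles. This descent cannot go on forever.

The bound holds on both sides of the plane, so the triad has at least 20 vertices, counted facet by
facet, less the excess over hexagons of the other facets. It has at most 18 plus its own excess, and
the total excess is at most 1: a contradiction (`IsSimple.not_isTriad`). Hence three pairwise
meeting facets share a vertex. Four pairwise meeting facets would force a triangle, so flagness
follows.

Euler's relation is proved by a sweep with a generic linear functional: each facet is counted at its
highest or lowest vertex, and the three edge directions at a simple vertex make the count local. -/

namespace ConvexPolytope

open Filter Topology Finset
open scoped Classical

/-! ### Vertices, edge directions and linear functionals on a polytope -/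

section Geometry

variable {n : ℕ} (P : ConvexPolytope n)

/-- The value at `x` of the affine function defining the `i`-th inequality. -/
noncomputable def slack (i : Fin P.m) (x : EuclideanSpace ℝ (Fin n)) : ℝ :=
  inner ℝ (P.a i) x + P.b i

/-- The indices of the inequalities that are equalities at `x`. -/
noncomputable def active (x : EuclideanSpace ℝ (Fin n)) : Finset (Fin P.m) :=
  univ.filter fun i => P.slack i x = 0

variable {P} {x y v w d u : EuclideanSpace ℝ (Fin n)} {i j k : Fin P.m} {S : Finset (Fin P.m)}

lemma mem_active : i ∈ P.active x ↔ P.slack i x = 0 := by simp [active]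

lemma mem_carrier : x ∈ P.carrier ↔ ∀ i, 0 ≤ P.slack i x := by
  simp [carrier, polyhedron, slack]

lemma mem_facet : x ∈ P.facet i ↔ x ∈ P.carrier ∧ i ∈ P.active x := by
  simp [facet, mem_active, slack]

lemma slack_add_smul (i : Fin P.m) (x d : EuclideanSpace ℝ (Fin n)) (t : ℝ) :
    P.slack i (x + t • d) = P.slack i x + t * inner ℝ (P.a i) d := by
  simp only [slack, inner_add_right, inner_smul_right]; ring

lemma inner_sub_eq_slack_sub (i : Fin P.m) (x y : EuclideanSpace ℝ (Fin n)) :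
    inner ℝ (P.a i) (x - y) = P.slack i x - P.slack i y := by
  simp only [slack, inner_sub_right]; ring

lemma slack_pos_of_notMem (hx : x ∈ P.carrier) (hi : i ∉ P.active x) : 0 < P.slack i x :=
  lt_of_le_of_ne (mem_carrier.1 hx i) fun h => hi (mem_active.2 h.symm)

/-- Otherwise the whole ray from `x` in direction `d` would stay in the bounded polytope. -/
lemma exists_inner_neg (hx : x ∈ P.carrier) (hd : d ≠ 0) : ∃ i, inner ℝ (P.a i) d < 0 := by
  by_contra! h
  obtain ⟨R, hR⟩ := isBounded_iff_forall_norm_le.1 P.bounded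
  have hd' : 0 < ‖d‖ := norm_pos_iff.2 hd
  have hR0 : 0 ≤ R := (norm_nonneg x).trans (hR x hx)
  set t := (R + ‖x‖ + 1) / ‖d‖ with ht
  have ht0 : 0 ≤ t := by positivity
  have hmem : x + t • d ∈ P.carrier := mem_carrier.2 fun i => by
    rw [slack_add_smul]
    have := mem_carrier.1 hx i
    have := mul_nonneg ht0 (h i)
    linarith
  have h1 := hR _ hmem
  have h2 : ‖t • d‖ = R + ‖x‖ + 1 := by
    rw [norm_smul, Real.norm_of_nonneg ht0, ht, div_mul_cancel₀ _ hd'.ne']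
  have h3 : ‖t • d‖ ≤ ‖x + t • d‖ + ‖x‖ := by
    simpa using norm_sub_le (x + t • d) x
  linarith

/-- The ratio test of the simplex method: slide along `d`, which keeps the active constraints tight,
until the first inactive one becomes tight. -/
lemma exists_step (hx : x ∈ P.carrier) (hd : d ≠ 0)
    (h : ∀ i ∈ P.active x, inner ℝ (P.a i) d = 0) :
    ∃ t : ℝ, 0 < t ∧ x + t • d ∈ P.carrier ∧ P.active x ⊂ P.active (x + t • d) := by
  obtain ⟨i₀, hi₀⟩ := exists_inner_neg hx hd
  obtain ⟨j, hj, hmin⟩ := (univ.filter fun i => inner ℝ (P.a i) d < 0).exists_min_image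
    (fun i => P.slack i x / -inner ℝ (P.a i) d) ⟨i₀, by simpa using hi₀⟩
  simp only [mem_filter, mem_univ, true_and] at hj hmin
  have hjx : j ∉ P.active x := fun hja => by simp [h j hja] at hj
  set t := P.slack j x / -inner ℝ (P.a j) d with ht
  have ht0 : 0 < t := div_pos (slack_pos_of_notMem hx hjx) (by linarith)
  refine ⟨t, ht0, mem_carrier.2 fun i => ?_, ?_⟩
  · rw [slack_add_smul]
    rcases lt_or_ge (inner ℝ (P.a i) d) 0 with hi | hi
    · have := hmin i hi
      rw [le_div_iff₀ (by linarith)] at this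
      linarith
    · have := mem_carrier.1 hx i
      have := mul_nonneg ht0.le hi
      linarith
  · refine (Finset.ssubset_iff_of_subset fun i hi => ?_).2 ⟨j, ?_, hjx⟩
    · rw [mem_active, slack_add_smul, h i hi, mem_active.1 hi]; simp
    · rw [mem_active, slack_add_smul, ht]
      have : inner ℝ (P.a j) d ≠ 0 := hj.ne
      field_simp; ring

/-- A direction orthogonal to all active normals would lead, by `exists_step`, to a second point of
the same face. This turns the set-theoretic notion of vertex into linear algebra. -/
lemma isVertex_iff : P.IsVertex v ↔
    v ∈ P.carrier ∧ ∀ d, (∀ i ∈ P.active v, inner ℝ (P.a i) d = 0) → d = 0 := by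
  constructor
  · rintro ⟨S, hS⟩
    have hv : v ∈ P.carrier ∩ ⋂ i ∈ S, P.facet i := hS ▸ Set.mem_singleton v
    refine ⟨hv.1, fun d hd => by_contra fun hd0 => ?_⟩
    obtain ⟨t, ht, hm, hsub⟩ := exists_step hv.1 hd0 hd
    have : v + t • d ∈ ({v} : Set _) := by
      rw [hS]
      refine ⟨hm, Set.mem_iInter₂.2 fun i hi => mem_facet.2 ⟨hm, hsub.1 ?_⟩⟩
      exact (mem_facet.1 (Set.mem_iInter₂.1 hv.2 i hi)).2
    simp [ht.ne', hd0] at this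
  · rintro ⟨hv, h⟩
    refine ⟨P.active v, Set.Subset.antisymm ?_ ?_⟩
    · rintro _ rfl
      exact ⟨hv, Set.mem_iInter₂.2 fun i hi => mem_facet.2 ⟨hv, hi⟩⟩
    · rintro x ⟨hx, hx'⟩
      refine sub_eq_zero.1 (h (x - v) fun i hi => ?_)
      have := (mem_facet.1 (Set.mem_iInter₂.1 hx' i hi)).2
      rw [inner_sub_eq_slack_sub, mem_active.1 this, mem_active.1 hi, sub_zero]

lemma IsVertex.mem_carrier (hv : P.IsVertex v) : v ∈ P.carrier := (isVertex_iff.1 hv).1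

lemma IsVertex.eq_of_active_subset (hv : P.IsVertex v) (h : P.active v ⊆ P.active x) : x = v := by
  refine sub_eq_zero.1 ((isVertex_iff.1 hv).2 (x - v) fun i hi => ?_)
  rw [inner_sub_eq_slack_sub, mem_active.1 hi, mem_active.1 (h hi), sub_zero]

/-- On the smallest face containing a point of the polytope, a linear functional is at least as
large at some vertex as at the given point. -/
theorem exists_vertex_ge (u : EuclideanSpace ℝ (Fin n)) (hx : x ∈ P.carrier) :
    ∃ v, P.IsVertex v ∧ P.active x ⊆ P.active v ∧ inner ℝ u x ≤ inner ℝ u v := by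
  -- Each step inside the face makes at least one more inequality active.
  induction hk : P.m - (P.active x).card using Nat.strong_induction_on generalizing x with
  | _ k ih =>
  by_cases hv : P.IsVertex x
  · exact ⟨x, hv, Subset.rfl, le_rfl⟩
  obtain ⟨d, hd, hd0, hu⟩ : ∃ d, (∀ i ∈ P.active x, inner ℝ (P.a i) d = 0) ∧ d ≠ 0 ∧
      0 ≤ inner ℝ u d := by
    rw [isVertex_iff] at hv
    push Not at hv
    obtain ⟨d, hd, hd0⟩ := hv hx
    rcases le_total 0 (inner ℝ u d) with h | h
    · exact ⟨d, hd, hd0, h⟩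
    · exact ⟨-d, by simpa using hd, by simpa using hd0, by simpa using h⟩
  obtain ⟨t, ht, hm, hsub⟩ := exists_step hx hd0 hd
  have hlt := card_lt_card hsub
  have hle : (P.active (x + t • d)).card ≤ P.m := by simpa using card_le_univ (P.active (x + t • d))
  obtain ⟨v, hv, hsv, huv⟩ := ih _ (by omega) hm rfl
  refine ⟨v, hv, hsub.1.trans hsv, le_trans ?_ huv⟩
  rw [inner_add_right, inner_smul_right]
  have := mul_nonneg ht.le hu
  linarith

lemma eventually_mem_carrier (hx : x ∈ P.carrier)
    (hd : ∀ i ∈ P.active x, 0 ≤ inner ℝ (P.a i) d) :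
    ∀ᶠ t : ℝ in 𝓝[>] 0, x + t • d ∈ P.carrier ∧ ∀ i ∉ P.active x, 0 < P.slack i (x + t • d) := by
  have h : ∀ᶠ t : ℝ in 𝓝[>] 0, ∀ i ∉ P.active x, 0 < P.slack i (x + t • d) := by
    refine eventually_all.2 fun i => ?_
    by_cases hi : i ∈ P.active x
    · exact Eventually.of_forall fun t h => absurd hi h
    have hc : Tendsto (fun t : ℝ => P.slack i x + t * inner ℝ (P.a i) d) (𝓝[>] 0)
        (𝓝 (P.slack i x + 0 * inner ℝ (P.a i) d)) :=
      (Continuous.tendsto (by fun_prop) 0).mono_left nhdsWithin_le_nhds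
    filter_upwards [hc.eventually_const_lt (u := 0)
      (by simpa using slack_pos_of_notMem hx hi)] with t ht _
    rwa [slack_add_smul]
  filter_upwards [h, self_mem_nhdsWithin] with t ht ht0
  refine ⟨mem_carrier.2 fun i => ?_, ht⟩
  by_cases hi : i ∈ P.active x
  · rw [slack_add_smul, mem_active.1 hi, zero_add]
    exact mul_nonneg (le_of_lt ht0) (hd i hi)
  · exact (ht i hi).le

lemma setOf_isVertex_finite : {v | P.IsVertex v}.Finite :=
  Set.Finite.of_finite_image (f := P.active) (Set.toFinite _) fun _ hv _ _ h =>
    (hv.eq_of_active_subset h.le).symm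

variable (P) in
/-- The vertices lying in all the facets with index in `S`. -/
noncomputable def verticesOf (S : Finset (Fin P.m)) : Finset (EuclideanSpace ℝ (Fin n)) :=
  P.setOf_isVertex_finite.toFinset.filter fun v => S ⊆ P.active v

lemma mem_verticesOf : v ∈ P.verticesOf S ↔ P.IsVertex v ∧ S ⊆ P.active v := by
  simp [verticesOf]

lemma IsSimple.card_active (hP : P.IsSimple) (hv : P.IsVertex v) : (P.active v).card = n := by
  refine Eq.trans ?_ (hP v hv)
  rw [← Set.ncard_coe_finset]
  congr 1
  ext i
  simp [mem_facet, hv.mem_carrier]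

variable (P v) in
/-- A basis dual to the normals of the facets through `v`. -/
def IsDual (d : Fin P.m → EuclideanSpace ℝ (Fin n)) : Prop :=
  (∀ i ∈ P.active v, ∀ j ∈ P.active v, inner ℝ (P.a j) (d i) = if j = i then 1 else 0) ∧
    ∀ x, x = ∑ i ∈ P.active v, inner ℝ (P.a i) x • d i

/-- There are as many active normals as dimensions, and pairing with them is injective by the vertex
criterion, hence bijective; the dual basis consists of preimages of unit vectors. -/
lemma IsSimple.exists_isDual (hP : P.IsSimple) (hv : P.IsVertex v) : ∃ d, P.IsDual v d := by
  let T : EuclideanSpace ℝ (Fin n) →ₗ[ℝ] (P.active v → ℝ) :=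
    LinearMap.pi fun i => (innerₛₗ ℝ (P.a i) : EuclideanSpace ℝ (Fin n) →ₗ[ℝ] ℝ)
  have hT : ∀ x i, T x i = inner ℝ (P.a i) x := fun x i => rfl
  have hinj : Function.Injective T := by
    refine (injective_iff_map_eq_zero T).2 fun x hx => (isVertex_iff.1 hv).2 x fun i hi => ?_
    rw [← hT x ⟨i, hi⟩, hx]; rfl
  have hsurj : Function.Surjective T :=
    (LinearMap.injective_iff_surjective_of_finrank_eq_finrank
      (by simp [hP.card_active hv])).1 hinj
  choose g hg using hsurj
  have key : ∀ i ∈ P.active v, ∀ hi : i ∈ P.active v, ∀ j (hj : j ∈ P.active v),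
      inner ℝ (P.a j) (g (Pi.single ⟨i, hi⟩ 1)) = if j = i then 1 else 0 := by
    intro i _ hi j hj
    rw [← hT _ ⟨j, hj⟩, hg, Pi.single_apply]
    simp
  have h1 : ∀ i ∈ P.active v, ∀ j ∈ P.active v,
      inner ℝ (P.a j) (if hi : i ∈ P.active v then g (Pi.single ⟨i, hi⟩ 1) else 0) =
        if j = i then 1 else 0 := fun i hi j hj => by
    rw [dif_pos hi]; exact key i hi hi j hj
  refine ⟨fun i => if hi : i ∈ P.active v then g (Pi.single ⟨i, hi⟩ 1) else 0, h1, fun x => ?_⟩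
  refine sub_eq_zero.1 ((isVertex_iff.1 hv).2 _ fun j hj => ?_)
  rw [inner_sub_right, inner_sum, sub_eq_zero]
  simp only [inner_smul_right]
  rw [sum_congr rfl fun i hi => by rw [h1 i hi j hj]]
  simp [hj]

variable (P) in
/-- The direction in which one leaves the `i`-th facet along an edge at the vertex `v`. -/
noncomputable def dir (v : EuclideanSpace ℝ (Fin n)) (i : Fin P.m) : EuclideanSpace ℝ (Fin n) :=
  if h : ∃ d, P.IsDual v d then h.choose i else 0

lemma IsSimple.isDual_dir (hP : P.IsSimple) (hv : P.IsVertex v) : P.IsDual v (P.dir v) := by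
  have h := hP.exists_isDual hv
  have : P.dir v = h.choose := by ext1 i; simp [dir, h]
  rw [this]
  exact h.choose_spec

lemma IsSimple.inner_dir (hP : P.IsSimple) (hv : P.IsVertex v) (hi : i ∈ P.active v)
    (hj : j ∈ P.active v) : inner ℝ (P.a j) (P.dir v i) = if j = i then 1 else 0 :=
  (hP.isDual_dir hv).1 i hi j hj

lemma IsSimple.dir_ne_zero (hP : P.IsSimple) (hv : P.IsVertex v) (hi : i ∈ P.active v) :
    P.dir v i ≠ 0 := fun h => by
  simpa [h] using hP.inner_dir hv hi hi

/-- The dual coordinates of `x - v` are the slacks of `x`, since the active slacks vanish at `v`. On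
the polytope they are nonnegative, so a face lies in the cone of its edge directions at `v`, and
local maxima become global. -/
lemma IsSimple.sub_eq_sum (hP : P.IsSimple) (hv : P.IsVertex v) (hx : S ⊆ P.active x) :
    x - v = ∑ i ∈ P.active v \ S, P.slack i x • P.dir v i := by
  conv_lhs => rw [(hP.isDual_dir hv).2 (x - v)]
  refine (sum_subset_zero_on_sdiff sdiff_subset (fun i hi => ?_) fun i hi => ?_).symm
  · simp only [Finset.mem_sdiff, not_and, not_not] at hi
    rw [inner_sub_eq_slack_sub, mem_active.1 hi.1, mem_active.1 (hx (hi.2 hi.1)), sub_zero,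
      zero_smul]
  · rw [inner_sub_eq_slack_sub, mem_active.1 (Finset.mem_sdiff.1 hi).1, sub_zero]

lemma IsSimple.eventually_edge_point (hP : P.IsSimple) (hv : P.IsVertex v) (hi : i ∈ P.active v) :
    ∀ᶠ t : ℝ in 𝓝[>] 0, v + t • P.dir v i ∈ P.carrier ∧
      P.active (v + t • P.dir v i) = (P.active v).erase i := by
  have h := eventually_mem_carrier (d := P.dir v i) hv.mem_carrier fun j hj => by
    rw [hP.inner_dir hv hi hj]; split_ifs <;> norm_num
  filter_upwards [h, self_mem_nhdsWithin] with t h ht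
  have ht : 0 < t := ht
  refine ⟨h.1, ?_⟩
  ext j
  rw [mem_erase]
  by_cases hj : j ∈ P.active v
  · rw [mem_active, slack_add_smul, mem_active.1 hj, hP.inner_dir hv hi hj]
    by_cases hji : j = i <;> simp [hji, ht.ne', hj]
  · simp [hj, mem_active, (h.2 j hj).ne']

lemma IsSimple.exists_edge_point (hP : P.IsSimple) (hv : P.IsVertex v) (hi : i ∈ P.active v) :
    ∃ t : ℝ, 0 < t ∧ v + t • P.dir v i ∈ P.carrier ∧
      P.active (v + t • P.dir v i) = (P.active v).erase i :=
  ((eventually_mem_nhdsWithin (a := (0 : ℝ))).and (hP.eventually_edge_point hv hi)).exists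

lemma IsSimple.exists_vertex_gt (hP : P.IsSimple) (hv : P.IsVertex v) (hi : i ∈ P.active v)
    (hu : 0 < inner ℝ u (P.dir v i)) :
    ∃ w, P.IsVertex w ∧ (P.active v).erase i ⊆ P.active w ∧ inner ℝ u v < inner ℝ u w := by
  obtain ⟨t, ht, hm, hact⟩ := hP.exists_edge_point hv hi
  obtain ⟨w, hw, hsub, hle⟩ := exists_vertex_ge u hm
  refine ⟨w, hw, hact ▸ hsub, lt_of_lt_of_le ?_ hle⟩
  rw [inner_add_right, inner_smul_right]
  have := mul_pos ht hu
  linarith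

/-! ### Peaks of a functional on a face, and dimensions of faces -/

variable (P u) in
/-- The functional `u` decreases along the edges at `v` of the face with facets in `S`. -/
def IsPeak (S : Finset (Fin P.m)) (v : EuclideanSpace ℝ (Fin n)) : Prop :=
  ∀ i ∈ P.active v \ S, inner ℝ u (P.dir v i) < 0

lemma IsSimple.le_of_isPeak (hP : P.IsSimple) (hv : P.IsVertex v) (h : P.IsPeak u S v)
    (hx : x ∈ P.carrier) (hSx : S ⊆ P.active x) : inner ℝ u x ≤ inner ℝ u v := by
  rw [← sub_nonpos, ← inner_sub_right, hP.sub_eq_sum hv hSx, inner_sum]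
  refine sum_nonpos fun i hi => ?_
  rw [inner_smul_right]
  exact mul_nonpos_of_nonneg_of_nonpos (mem_carrier.1 hx i) (h i hi).le

lemma IsSimple.eq_of_isPeak (hP : P.IsSimple) (hv : P.IsVertex v) (h : P.IsPeak u S v)
    (hx : x ∈ P.carrier) (hSx : S ⊆ P.active x) (hle : inner ℝ u v ≤ inner ℝ u x) : x = v := by
  have h0 : ∀ i ∈ P.active v \ S, P.slack i x * inner ℝ u (P.dir v i) ≤ 0 := fun i hi =>
    mul_nonpos_of_nonneg_of_nonpos (mem_carrier.1 hx i) (h i hi).le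
  have hsum : ∑ i ∈ P.active v \ S, P.slack i x * inner ℝ u (P.dir v i) = 0 := by
    refine le_antisymm (sum_nonpos h0) ?_
    have := hP.sub_eq_sum hv hSx
    apply_fun (inner ℝ u) at this
    rw [inner_sum, inner_sub_right] at this
    simp only [inner_smul_right] at this
    linarith
  rw [sum_eq_zero_iff_of_nonpos h0] at hsum
  rw [← sub_eq_zero, hP.sub_eq_sum hv hSx]
  refine sum_eq_zero fun i hi => ?_
  rw [(mul_eq_zero.1 (hsum i hi)).resolve_right (h i hi).ne, zero_smul]

/-- A functional that is not constant on any edge has exactly one peak on a nonempty face. -/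
theorem IsSimple.existsUnique_isPeak (hP : P.IsSimple)
    (hu : ∀ v, P.IsVertex v → ∀ i ∈ P.active v, inner ℝ u (P.dir v i) ≠ 0)
    (hS : (P.verticesOf S).Nonempty) : ∃! v, v ∈ P.verticesOf S ∧ P.IsPeak u S v := by
  obtain ⟨v, hv, hmax⟩ := (P.verticesOf S).exists_max_image (inner ℝ u) hS
  have hv' := mem_verticesOf.1 hv
  have hpk : P.IsPeak u S v := fun i hi => by
    rw [Finset.mem_sdiff] at hi
    refine lt_of_le_of_ne (not_lt.1 fun hpos => ?_) (hu v hv'.1 i hi.1)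
    obtain ⟨w, hw, hsub, hlt⟩ := hP.exists_vertex_gt hv'.1 hi.1 hpos
    refine (hmax w (mem_verticesOf.2 ⟨hw, fun j hj => hsub ?_⟩)).not_gt hlt
    exact mem_erase.2 ⟨fun h => hi.2 (h ▸ hj), hv'.2 hj⟩
  refine ⟨v, ⟨hv, hpk⟩, fun w hw => ?_⟩
  have hw' := mem_verticesOf.1 hw.1
  exact hP.eq_of_isPeak hv'.1 hpk hw'.1.mem_carrier hw'.2
    (hP.le_of_isPeak hw'.1 hw.2 hv'.1.mem_carrier hv'.2)

variable (P) in
/-- The face in which the inequalities with index in `S` are equalities. -/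
def face (S : Finset (Fin P.m)) : Set (EuclideanSpace ℝ (Fin n)) :=
  {x | x ∈ P.carrier ∧ S ⊆ P.active x}

lemma carrier_inter_iInter_facet (T : Set (Fin P.m)) :
    P.carrier ∩ ⋂ i ∈ T, P.facet i = P.face T.toFinset := by
  ext x
  simp only [Set.mem_inter_iff, Set.mem_iInter, mem_facet, face, Set.mem_ofPred_eq, subset_iff,
    Set.mem_toFinset]
  exact ⟨fun h => ⟨h.1, fun i hi => (h.2 i hi).2⟩, fun h => ⟨h.1, fun i hi => ⟨h.1, h.2 hi⟩⟩⟩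

lemma isFace_iff {F : Set (EuclideanSpace ℝ (Fin n))} : P.IsFace F ↔ ∃ S, F = P.face S := by
  constructor
  · rintro ⟨T, rfl⟩
    exact ⟨_, carrier_inter_iInter_facet T⟩
  · rintro ⟨S, rfl⟩
    exact ⟨S, by rw [carrier_inter_iInter_facet]; simp⟩

/-- A face of a simple polytope given by `k` facets has codimension `k`. -/
theorem IsSimple.finrank_vectorSpan_face (hP : P.IsSimple) (hv : v ∈ P.verticesOf S) :
    Module.finrank ℝ (vectorSpan ℝ (P.face S)) = n - S.card := by
  obtain ⟨hv, hS⟩ := mem_verticesOf.1 hv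
  have hspan : vectorSpan ℝ (P.face S) =
      Submodule.span ℝ (Set.range fun i : ↥(P.active v \ S) => P.dir v i) := by
    have hvm : v ∈ P.face S := ⟨hv.mem_carrier, hS⟩
    apply le_antisymm
    · rw [vectorSpan_eq_span_vsub_set_right ℝ hvm, Submodule.span_le]
      rintro _ ⟨x, hx, rfl⟩
      simp only [vsub_eq_sub]
      rw [hP.sub_eq_sum hv hx.2]
      exact Submodule.sum_mem _ fun i hi =>
        Submodule.smul_mem _ _ (Submodule.subset_span ⟨⟨i, hi⟩, rfl⟩)
    · rw [Submodule.span_le]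
      rintro _ ⟨⟨i, hi⟩, rfl⟩
      rw [Finset.mem_sdiff] at hi
      obtain ⟨t, ht, hm, hact⟩ := hP.exists_edge_point hv hi.1
      have h1 : v + t • P.dir v i ∈ P.face S :=
        ⟨hm, fun j hj => hact ▸ mem_erase.2 ⟨fun h => hi.2 (h ▸ hj), hS hj⟩⟩
      have h2 := Submodule.smul_mem _ t⁻¹ (vsub_mem_vectorSpan ℝ h1 hvm)
      simpa [smul_smul, inv_mul_cancel₀ ht.ne'] using h2
  have hli : LinearIndependent ℝ fun i : ↥(P.active v \ S) => P.dir v i := by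
    rw [Fintype.linearIndependent_iff]
    intro g hg j
    have hj := (Finset.mem_sdiff.1 j.2).1
    apply_fun (inner ℝ (P.a j)) at hg
    rw [inner_sum, inner_zero_right] at hg
    simp only [inner_smul_right] at hg
    rw [sum_congr rfl fun i _ => by rw [hP.inner_dir hv (Finset.mem_sdiff.1 i.2).1 hj]] at hg
    simpa [Subtype.coe_inj] using hg
  rw [hspan, finrank_span_eq_card hli, Fintype.card_coe, card_sdiff_of_subset hS,
    hP.card_active hv]

end Geometry

/-! ### Incidences of vertices, edges and facets in dimension three -/

section Combinatorics

variable {P : ConvexPolytope 3} {x y v w d u : EuclideanSpace ℝ (Fin 3)} {i j k : Fin P.m}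
  {S T : Finset (Fin P.m)} {c : ℝ}

lemma mem_verticesOf_singleton : v ∈ P.verticesOf {i} ↔ P.IsVertex v ∧ i ∈ P.active v := by
  simp [mem_verticesOf]

lemma mem_verticesOf_pair :
    v ∈ P.verticesOf {i, j} ↔ P.IsVertex v ∧ i ∈ P.active v ∧ j ∈ P.active v := by
  simp [mem_verticesOf, insert_subset_iff]

lemma verticesOf_nonempty_of_mem_face (hx : x ∈ P.face S) : (P.verticesOf S).Nonempty :=
  let ⟨v, hv, hsub, _⟩ := exists_vertex_ge 0 hx.1
  ⟨v, mem_verticesOf.2 ⟨hv, hx.2.trans hsub⟩⟩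

lemma facet_inter_facet (i j : Fin P.m) : P.facet i ∩ P.facet j = P.face {i, j} := by
  ext x
  simp only [Set.mem_inter_iff, mem_facet, face, Set.mem_ofPred_eq, insert_subset_iff,
    singleton_subset_iff]
  tauto

lemma IsSimple.eq_insert_of_mem (hP : P.IsSimple) (hv : P.IsVertex v) (hij : i ≠ j) (hik : i ≠ k)
    (hjk : j ≠ k) (hi : i ∈ P.active v) (hj : j ∈ P.active v) (hk : k ∈ P.active v) :
    P.active v = {i, j, k} := by
  refine (eq_of_subset_of_card_le ?_ ?_).symm
  · simp [insert_subset_iff, hi, hj, hk]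
  · rw [hP.card_active hv, card_eq_three.2 ⟨i, j, k, hij, hik, hjk, rfl⟩]

lemma IsSimple.eq_of_mem_active (hP : P.IsSimple) (hv : P.IsVertex v) (hw : P.IsVertex w)
    (hij : i ≠ j) (hik : i ≠ k) (hjk : j ≠ k)
    (hvi : i ∈ P.active v) (hvj : j ∈ P.active v) (hvk : k ∈ P.active v)
    (hwi : i ∈ P.active w) (hwj : j ∈ P.active w) (hwk : k ∈ P.active w) : v = w := by
  refine hw.eq_of_active_subset ?_
  rw [hP.eq_insert_of_mem hv hij hik hjk hvi hvj hvk,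
    hP.eq_insert_of_mem hw hij hik hjk hwi hwj hwk]

lemma IsSimple.exists_third (hP : P.IsSimple) (hv : P.IsVertex v) (hij : i ≠ j)
    (hi : i ∈ P.active v) (hj : j ∈ P.active v) :
    ∃ k, k ≠ i ∧ k ≠ j ∧ P.active v = {i, j, k} := by
  have h1 : ({i, j} : Finset (Fin P.m)) ⊆ P.active v := by simp [insert_subset_iff, hi, hj]
  have h2 : (P.active v \ {i, j}).card = 1 := by
    rw [card_sdiff_of_subset h1, hP.card_active hv, card_pair hij]
  obtain ⟨k, hk⟩ := card_eq_one.1 h2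
  have hk' : k ∈ P.active v \ {i, j} := by simp [hk]
  simp only [Finset.mem_sdiff, mem_insert, mem_singleton, not_or] at hk'
  exact ⟨k, hk'.2.1, hk'.2.2,
    hP.eq_insert_of_mem hv hij (Ne.symm hk'.2.1) (Ne.symm hk'.2.2) hi hj hk'.1⟩

/-- Two facets of a simple `3`-polytope that meet have exactly two vertices in common. -/
theorem IsSimple.card_verticesOf_pair (hP : P.IsSimple) (hij : i ≠ j)
    (h : (P.verticesOf {i, j}).Nonempty) : (P.verticesOf {i, j}).card = 2 := by
  have hsub : ∀ {p x}, p ∈ P.verticesOf {i, j} → x ∈ P.verticesOf {i, j} →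
      ∀ k, k ≠ i → k ≠ j → P.active p = {i, j, k} → x - p = P.slack k x • P.dir p k := by
    intro p x hp hx k hki hkj hact
    rw [hP.sub_eq_sum (mem_verticesOf.1 hp).1 (mem_verticesOf.1 hx).2, hact,
      show ({i, j, k} : Finset (Fin P.m)) \ {i, j} = {k} by ext l; simp; grind, sum_singleton]
  obtain ⟨v, hv⟩ := h
  have hv' := mem_verticesOf_pair.1 hv
  obtain ⟨k, hki, hkj, hact⟩ := hP.exists_third hv'.1 hij hv'.2.1 hv'.2.2
  have hkv : k ∈ P.active v := by simp [hact]
  apply le_antisymm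
  · by_contra! hlt
    obtain ⟨p, hp, q, hq, r, hr, hpq, hpr, hqr⟩ := two_lt_card.1 hlt
    -- `P.slack k` is a coordinate on the line of the edge. From any vertex `p` on it, all its
    -- points lie in the single direction `P.dir p l`, so `p` is an end.
    have key : ∀ p ∈ P.verticesOf {i, j}, ∀ x ∈ P.verticesOf {i, j}, ∀ y ∈ P.verticesOf {i, j},
        0 ≤ (P.slack k x - P.slack k p) * (P.slack k y - P.slack k p) := by
      intro p hp x hx y hy
      have hp' := mem_verticesOf_pair.1 hp
      obtain ⟨l, hli, hlj, hl⟩ := hP.exists_third hp'.1 hij hp'.2.1 hp'.2.2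
      rw [← inner_sub_eq_slack_sub, ← inner_sub_eq_slack_sub, hsub hp hx l hli hlj hl,
        hsub hp hy l hli hlj hl, inner_smul_right, inner_smul_right]
      have h1 := mem_carrier.1 (mem_verticesOf.1 hx).1.mem_carrier l
      have h2 := mem_carrier.1 (mem_verticesOf.1 hy).1.mem_carrier l
      have := mul_nonneg (mul_nonneg h1 h2) (mul_self_nonneg (inner ℝ (P.a k) (P.dir p l)))
      linarith
    have hne : ∀ p ∈ P.verticesOf {i, j}, ∀ x ∈ P.verticesOf {i, j}, p ≠ x →
        P.slack k p - P.slack k x ≠ 0 := by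
      intro p hp x hx hne h0
      refine hne (sub_left_injective (b := v) (?_ : p - v = x - v))
      rw [hsub hv hp k hki hkj hact, hsub hv hx k hki hkj hact, sub_eq_zero.1 h0]
    -- For three distinct points the three `key` products multiply to minus a nonzero square.
    have h1 := mul_nonneg (mul_nonneg (key p hp q hq r hr) (key q hq p hp r hr))
      (key r hr p hp q hq)
    have h2 := sq_pos_of_ne_zero (mul_ne_zero (mul_ne_zero (hne p hp q hq hpq)
      (hne p hp r hr hpr)) (hne q hq r hr hqr))
    nlinarith
  · have hpos : 0 < inner ℝ (P.dir v k) (P.dir v k) :=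
      real_inner_self_pos.2 (hP.dir_ne_zero hv'.1 hkv)
    obtain ⟨w, hw, hsub, hlt⟩ := hP.exists_vertex_gt hv'.1 hkv hpos
    refine one_lt_card.2 ⟨v, hv, w, mem_verticesOf_pair.2 ⟨hw, hsub ?_, hsub ?_⟩, ?_⟩
    · exact mem_erase.2 ⟨hki.symm, hv'.2.1⟩
    · exact mem_erase.2 ⟨hkj.symm, hv'.2.2⟩
    · rintro rfl
      exact hlt.false

lemma IsSimple.isEdge_facet_inter (hP : P.IsSimple) (hij : i ≠ j)
    (h : (P.verticesOf {i, j}).Nonempty) : P.IsEdge (P.face {i, j}) := by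
  obtain ⟨v, hv⟩ := h
  exact ⟨isFace_iff.2 ⟨_, rfl⟩, by rw [hP.finrank_vectorSpan_face hv, card_pair hij]⟩

/-- Since the edge lies in facet `i`, that index may be added to the defining set; dimension one
then leaves room for exactly one more. -/
lemma IsSimple.isEdge_and_subset_facet_iff (hP : P.IsSimple)
    {E : Set (EuclideanSpace ℝ (Fin 3))} :
    P.IsEdge E ∧ E ⊆ P.facet i ↔ ∃ j, (j ≠ i ∧ (P.verticesOf {i, j}).Nonempty) ∧
      P.face {i, j} = E := by
  constructor
  · rintro ⟨⟨hF, hdim⟩, hsub⟩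
    obtain ⟨S, rfl⟩ := isFace_iff.1 hF
    have hins : P.face (insert i S) = P.face S := by
      ext x
      simp only [face, Set.mem_ofPred_eq, insert_subset_iff]
      exact ⟨fun h => ⟨h.1, h.2.2⟩, fun h => ⟨h.1, (mem_facet.1 (hsub h)).2, h.2⟩⟩
    rw [← hins] at hdim ⊢
    have hne : (P.face (insert i S)).Nonempty := by
      by_contra h
      rw [Set.not_nonempty_iff_eq_empty.1 h, vectorSpan_empty, finrank_bot] at hdim
      exact zero_ne_one hdim
    obtain ⟨v, hv⟩ := verticesOf_nonempty_of_mem_face hne.some_mem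
    rw [hP.finrank_vectorSpan_face hv] at hdim
    have h1 : ((insert i S).erase i).card = 1 := by
      rw [card_erase_of_mem (mem_insert_self _ _)]; omega
    obtain ⟨j, hj⟩ := card_eq_one.1 h1
    have hji : j ∈ (insert i S).erase i := by simp [hj]
    have h2 : ({i, j} : Finset _) = insert i S := by
      rw [← insert_erase (mem_insert_self i S), hj]
    exact ⟨j, ⟨(mem_erase.1 hji).1, h2 ▸ ⟨v, hv⟩⟩, by rw [h2]⟩
  · rintro ⟨j, ⟨hji, hne⟩, rfl⟩
    exact ⟨hP.isEdge_facet_inter hji.symm hne,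
      fun x hx => mem_facet.2 ⟨hx.1, hx.2 (mem_insert_self _ _)⟩⟩

/-- A facet of a simple `3`-polytope has as many edges as vertices. -/
theorem IsSimple.numEdges_eq (hP : P.IsSimple) (i : Fin P.m) :
    P.numEdges i = (P.verticesOf {i}).card := by
  set N := univ.filter fun j => j ≠ i ∧ (P.verticesOf {i, j}).Nonempty with hN
  have hset : {E | P.IsEdge E ∧ E ⊆ P.facet i} = (fun j => P.face {i, j}) '' (N : Set _) := by
    ext E
    rw [Set.mem_ofPred_eq, hP.isEdge_and_subset_facet_iff]
    simp [hN]
  -- An edge has two vertices, and distinct vertices cannot share three facets.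
  have hinj : Set.InjOn (fun j => P.face {i, j}) (N : Set (Fin P.m)) := by
    intro j hj k hk hjk
    simp only [hN, coe_filter, mem_univ, true_and, Set.mem_ofPred_eq] at hj hk
    by_contra hne
    obtain ⟨v, hv, w, hw, hvw⟩ := one_lt_card.1
      ((hP.card_verticesOf_pair hj.1.symm hj.2).symm ▸ one_lt_two)
    have h : ∀ v ∈ P.verticesOf {i, j}, k ∈ P.active v := fun v hv => by
      have h1 : v ∈ P.face {i, j} := ⟨(mem_verticesOf.1 hv).1.mem_carrier, (mem_verticesOf.1 hv).2⟩
      have h2 : v ∈ P.face {i, k} := hjk.le h1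
      exact h2.2 (by simp)
    have hv' := mem_verticesOf_pair.1 hv
    have hw' := mem_verticesOf_pair.1 hw
    exact hvw (hP.eq_of_mem_active hv'.1 hw'.1 hj.1.symm hk.1.symm hne hv'.2.1 hv'.2.2 (h v hv)
      hw'.2.1 hw'.2.2 (h w hw))
  -- Count incidences of neighbours and vertices: each neighbour shares two vertices with facet `i`,
  -- and each vertex of it lies in two other facets.
  have hcount := sum_card_bipartiteAbove_eq_sum_card_bipartiteBelow (s := N)
    (t := P.verticesOf {i}) fun j v => j ∈ P.active v
  rw [sum_congr rfl fun j hj => show (bipartiteAbove (fun j v => j ∈ P.active v)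
      (P.verticesOf {i}) j).card = 2 by
    simp only [hN, mem_filter, mem_univ, true_and] at hj
    rw [← hP.card_verticesOf_pair hj.1.symm hj.2]
    congr 1
    ext v
    simp [mem_verticesOf_pair, mem_verticesOf_singleton, and_assoc],
    sum_congr rfl fun v hv => show (bipartiteBelow (fun j v => j ∈ P.active v) N v).card = 2 by
    rw [mem_verticesOf_singleton] at hv
    refine Eq.trans ?_ ((card_erase_of_mem hv.2).trans (by rw [hP.card_active hv.1]))
    congr 1
    ext j
    simp only [mem_bipartiteBelow, hN, mem_filter, mem_univ, true_and, mem_erase]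
    exact ⟨fun h => ⟨h.1.1, h.2⟩,
      fun h => ⟨⟨h.1, v, mem_verticesOf_pair.2 ⟨hv.1, hv.2, h.2⟩⟩, h.2⟩⟩] at hcount
  rw [numEdges, hset, hinj.ncard_image, Set.ncard_coe_finset]
  simpa using hcount

/-- A nonempty set of vertices of a facet that is closed under adjacency contains all vertices of
the facet. -/
theorem IsSimple.mem_of_closed (hP : P.IsSimple) {T : Finset (EuclideanSpace ℝ (Fin 3))}
    (hT : T ⊆ P.verticesOf {i}) (hne : T.Nonempty)
    (hclosed : ∀ v ∈ T, ∀ j ∈ P.active v, j ≠ i → P.verticesOf {i, j} ⊆ T) :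
    T = P.verticesOf {i} := by
  refine hT.antisymm fun w hw => ?_
  rw [mem_verticesOf_singleton] at hw
  -- On the polytope this functional is maximal exactly at `w`, where all these slacks vanish.
  set u := -∑ k ∈ P.active w, P.a k with hu
  have huv : ∀ x y, inner ℝ u (x - y) = ∑ k ∈ P.active w, (P.slack k y - P.slack k x) := by
    intro x y
    rw [hu, inner_neg_left, sum_inner, ← sum_neg_distrib]
    exact sum_congr rfl fun k _ => by rw [inner_sub_eq_slack_sub]; ring
  obtain ⟨v, hv, hmax⟩ := T.exists_max_image (inner ℝ u) hne
  have hv' := mem_verticesOf_singleton.1 (hT hv)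
  suffices hle : inner ℝ u w ≤ inner ℝ u v by
    rw [← sub_nonneg, ← inner_sub_right, huv] at hle
    have h0 : ∀ k ∈ P.active w, 0 ≤ P.slack k v := fun k _ => mem_carrier.1 hv'.1.mem_carrier k
    have h1 : ∑ k ∈ P.active w, P.slack k v = 0 := by
      refine le_antisymm ?_ (sum_nonneg h0)
      rw [sum_sub_distrib, sum_eq_zero (f := fun k => P.slack k w) fun k hk => mem_active.1 hk]
        at hle
      linarith
    rw [sum_eq_zero_iff_of_nonneg h0] at h1
    rwa [← hw.1.eq_of_active_subset fun k hk => mem_active.2 (h1 k hk)]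
  -- As `T` is closed under adjacency, `v` is a local maximum on the facet, hence a global one.
  rw [← sub_nonpos, ← inner_sub_right, hP.sub_eq_sum hv'.1 (singleton_subset_iff.2 hw.2),
    inner_sum]
  refine sum_nonpos fun k hk => ?_
  rw [inner_smul_right]
  refine mul_nonpos_of_nonneg_of_nonpos (mem_carrier.1 hw.1.mem_carrier k) (not_lt.1 fun hpos => ?_)
  rw [Finset.mem_sdiff, mem_singleton] at hk
  obtain ⟨z, hz, hsub, hlt⟩ := hP.exists_vertex_gt hv'.1 hk.1 hpos
  obtain ⟨j, hji, hjk, hact⟩ := hP.exists_third hv'.1 (Ne.symm hk.2) hv'.2 hk.1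
  have hjv : j ∈ P.active v := by simp [hact]
  refine (hmax z (hclosed v hv j hjv hji (mem_verticesOf_pair.2 ⟨hz, hsub ?_, hsub ?_⟩))).not_gt hlt
  · exact mem_erase.2 ⟨Ne.symm hk.2, hv'.2⟩
  · exact mem_erase.2 ⟨hjk, hjv⟩

/-! ### Euler's relation above a plane -/

/-- If d of the three edges descend from `v`, then `v` is the top of 0, 0, 1, 3 of its facets for d
= 0, 1, 2, 3, and the bottom of 3, 1, 0, 0 of them. -/
lemma IsSimple.card_isPeak_add (hP : P.IsSimple) (hv : P.IsVertex v)
    (hu : ∀ i ∈ P.active v, inner ℝ u (P.dir v i) ≠ 0) :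
    ((P.active v).filter fun i => P.IsPeak u {i} v).card +
      ((P.active v).filter fun i => P.IsPeak (-u) {i} v).card =
    1 + 2 * (if P.IsPeak u ∅ v then 1 else 0) + 2 * (if P.IsPeak (-u) ∅ v then 1 else 0) := by
  obtain ⟨i, j, k, hij, hik, hjk, hact⟩ := card_eq_three.1 (hP.card_active hv)
  have h1 : ∀ z l, P.IsPeak z {l} v ↔ (i ≠ l → inner ℝ z (P.dir v i) < 0) ∧
      (j ≠ l → inner ℝ z (P.dir v j) < 0) ∧ (k ≠ l → inner ℝ z (P.dir v k) < 0) := by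
    intro z l
    simp only [IsPeak, hact, Finset.mem_sdiff, mem_insert, mem_singleton]
    grind
  have h0 : ∀ z, P.IsPeak z ∅ v ↔ inner ℝ z (P.dir v i) < 0 ∧
      inner ℝ z (P.dir v j) < 0 ∧ inner ℝ z (P.dir v k) < 0 := by
    intro z
    simp [IsPeak, hact]
  simp only [h1, h0, hact, inner_neg_left, neg_lt_zero, filter_insert, filter_singleton]
  have hi := hu i (by simp [hact])
  have hj := hu j (by simp [hact])
  have hk := hu k (by simp [hact])
  rcases hi.lt_or_gt with hi | hi <;> rcases hj.lt_or_gt with hj | hj <;>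
    rcases hk.lt_or_gt with hk | hk <;>
    simp [hi, hj, hk, hi.not_gt, hj.not_gt, hk.not_gt, hij, hik, hjk, hij.symm, hik.symm, hjk.symm]

lemma sum_card_filter_active {V : Finset (EuclideanSpace ℝ (Fin 3))}
    {p : Fin P.m → Prop} [DecidablePred p] {q : Fin P.m → EuclideanSpace ℝ (Fin 3) → Prop}
    (h : ∀ i, ∀ v ∈ V, i ∈ P.active v → q i v → p i)
    (h' : ∀ i, p i → ∃! v, (v ∈ V ∧ i ∈ P.active v) ∧ q i v) :
    ∑ v ∈ V, ((P.active v).filter fun i => q i v).card = (univ.filter p).card := by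
  have hcount := sum_card_bipartiteAbove_eq_sum_card_bipartiteBelow (s := univ) (t := V)
    fun i v => i ∈ P.active v ∧ q i v
  rw [card_filter]
  refine Eq.trans (sum_congr rfl fun v _ => ?_) (hcount.symm.trans (sum_congr rfl fun i _ => ?_))
  · congr 1; ext i; simp
  · split_ifs with hp
    · obtain ⟨v, hv, huniq⟩ := h' i hp
      refine card_eq_one.2 ⟨v, ?_⟩
      ext w
      simp only [mem_bipartiteAbove, mem_singleton]
      exact ⟨fun hw => huniq w ⟨⟨hw.1, hw.2.1⟩, hw.2.2⟩, fun hw => hw ▸ ⟨hv.1.1, hv.1.2, hv.2⟩⟩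
    · refine card_eq_zero.2 (filter_eq_empty_iff.2 fun v hv hq => hp (h i v hv hq.1 hq.2))

variable (P u c) in
/-- The vertices at which the affine functional `⟪u, ·⟫ - c` is positive. -/
noncomputable def upper : Finset (EuclideanSpace ℝ (Fin 3)) :=
  (P.verticesOf ∅).filter fun v => c < inner ℝ u v

lemma mem_upper : v ∈ P.upper u c ↔ P.IsVertex v ∧ c < inner ℝ u v := by
  simp [upper, mem_verticesOf]

/-- Sum `card_isPeak_add` over the upper vertices. A facet reaches above the plane iff its top
vertex does, and lies wholly above iff its bottom vertex does. The top of the polytope contributes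
the 2; its bottom is not among the upper vertices. -/
lemma IsSimple.card_upper_add_two_of_generic (hP : P.IsSimple)
    (hu : ∀ v, P.IsVertex v → ∀ i ∈ P.active v, inner ℝ u (P.dir v i) ≠ 0)
    (hpos : ∃ v, P.IsVertex v ∧ c < inner ℝ u v) (hneg : ∃ v, P.IsVertex v ∧ inner ℝ u v ≤ c) :
    (P.upper u c).card + 2 =
      (univ.filter fun i => ∃ v ∈ P.verticesOf {i}, c < inner ℝ u v).card +
      (univ.filter fun i => (P.verticesOf {i}).Nonempty ∧
        ∀ v ∈ P.verticesOf {i}, c < inner ℝ u v).card := by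
  have hu' : ∀ v, P.IsVertex v → ∀ i ∈ P.active v, inner ℝ (-u) (P.dir v i) ≠ 0 :=
    fun v hv i hi => by simpa using hu v hv i hi
  rw [← sum_card_filter_active (V := P.upper u c) (q := fun i v => P.IsPeak u {i} v) ?_ ?_,
    ← sum_card_filter_active (V := P.upper u c) (q := fun i v => P.IsPeak (-u) {i} v) ?_ ?_,
    ← sum_add_distrib, sum_congr rfl fun v hv =>
      hP.card_isPeak_add (mem_upper.1 hv).1 (hu v (mem_upper.1 hv).1)]
  rw [sum_add_distrib, sum_add_distrib, ← mul_sum, ← mul_sum, ← card_filter, ← card_filter]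
  have hne : ∀ {v}, P.IsVertex v → (P.verticesOf ∅).Nonempty := fun hv =>
    ⟨_, mem_verticesOf.2 ⟨hv, empty_subset _⟩⟩
  have h1 : ((P.upper u c).filter fun v => P.IsPeak u ∅ v).card = 1 := by
    obtain ⟨w, hw, hcw⟩ := hpos
    obtain ⟨v, ⟨hv, hpk⟩, huniq⟩ := hP.existsUnique_isPeak hu (hne hw)
    rw [mem_verticesOf] at hv
    refine card_eq_one.2 ⟨v, ?_⟩
    ext z
    simp only [mem_filter, mem_upper, mem_singleton]
    refine ⟨fun hz => huniq z ⟨mem_verticesOf.2 ⟨hz.1.1, empty_subset _⟩, hz.2⟩, ?_⟩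
    rintro rfl
    exact ⟨⟨hv.1, hcw.trans_le (hP.le_of_isPeak hv.1 hpk hw.mem_carrier (empty_subset _))⟩, hpk⟩
  have h2 : ((P.upper u c).filter fun v => P.IsPeak (-u) ∅ v).card = 0 := by
    obtain ⟨w, hw, hcw⟩ := hneg
    refine card_eq_zero.2 (filter_eq_empty_iff.2 fun v hv hpk => ?_)
    rw [mem_upper] at hv
    have := hP.le_of_isPeak hv.1 hpk hw.mem_carrier (empty_subset _)
    simp only [inner_neg_left] at this
    linarith [hv.2]
  rw [h1, h2]
  simp
  · rintro i v hv hi hpk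
    rw [mem_upper] at hv
    refine ⟨⟨v, mem_verticesOf_singleton.2 ⟨hv.1, hi⟩⟩, fun w hw => ?_⟩
    rw [mem_verticesOf] at hw
    have := hP.le_of_isPeak hv.1 hpk hw.1.mem_carrier hw.2
    simp only [inner_neg_left] at this
    linarith [hv.2]
  · rintro i ⟨hne, hall⟩
    obtain ⟨v, ⟨hv, hpk⟩, huniq⟩ := hP.existsUnique_isPeak hu' hne
    have hv' := mem_verticesOf_singleton.1 hv
    refine ⟨v, ⟨⟨mem_upper.2 ⟨hv'.1, hall v hv⟩, hv'.2⟩, hpk⟩, fun z hz => ?_⟩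
    exact huniq z ⟨mem_verticesOf_singleton.2 ⟨(mem_upper.1 hz.1.1).1, hz.1.2⟩, hz.2⟩
  · rintro i v hv hi -
    rw [mem_upper] at hv
    exact ⟨v, mem_verticesOf_singleton.2 ⟨hv.1, hi⟩, hv.2⟩
  · rintro i ⟨w, hw, hcw⟩
    obtain ⟨v, ⟨hv, hpk⟩, huniq⟩ := hP.existsUnique_isPeak hu ⟨w, hw⟩
    have hv' := mem_verticesOf_singleton.1 hv
    have hw' := mem_verticesOf.1 hw
    refine ⟨v, ⟨⟨mem_upper.2 ⟨hv'.1, hcw.trans_le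
      (hP.le_of_isPeak hv'.1 hpk hw'.1.mem_carrier hw'.2)⟩, hv'.2⟩, hpk⟩, fun z hz => ?_⟩
    exact huniq z ⟨mem_verticesOf_singleton.2 ⟨(mem_upper.1 hz.1.1).1, hz.1.2⟩, hz.2⟩

/-- There are finitely many edge directions, and the complement of each orthogonal plane is open and
dense. -/
lemma IsSimple.exists_generic (hP : P.IsSimple) {U : Set (EuclideanSpace ℝ (Fin 3))}
    (hU : U ∈ 𝓝 u) :
    ∃ z ∈ U, ∀ v, P.IsVertex v → ∀ i ∈ P.active v, inner ℝ z (P.dir v i) ≠ 0 := by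
  set D := (P.verticesOf ∅).biUnion fun v => (P.active v).image (P.dir v) with hD
  have hdense : Dense (⋂ d ∈ (D : Set (EuclideanSpace ℝ (Fin 3))), {z | inner ℝ z d ≠ 0}) := by
    refine dense_biInter_of_isOpen (fun d _ => isOpen_ne_fun (by fun_prop) (by fun_prop))
      D.countable_toSet fun d hd => ?_
    have hd0 : d ≠ 0 := by
      simp only [hD, coe_biUnion, Set.mem_iUnion, coe_image, Set.mem_image] at hd
      obtain ⟨v, hv, i, hi, rfl⟩ := hd
      exact hP.dir_ne_zero (mem_verticesOf.1 hv).1 hi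
    have hopen : IsOpenMap (innerSL ℝ d) := by
      refine ContinuousLinearMap.isOpenMap_of_ne_zero _ fun h => hd0 ?_
      simpa using congrArg (fun f => f d) h
    have := (dense_compl_singleton (0 : ℝ)).preimage hopen
    convert this using 1
    ext z
    simp [real_inner_comm]
  obtain ⟨z, hz, hzU⟩ := hdense.inter_nhds_nonempty hU
  refine ⟨z, hzU, fun v hv i hi => Set.mem_iInter₂.1 hz _ ?_⟩
  simp only [hD, coe_biUnion, Set.mem_iUnion, coe_image, Set.mem_image]
  exact ⟨v, mem_verticesOf.2 ⟨hv, empty_subset _⟩, i, hi, rfl⟩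

/-- The Euler relation for the part of a simple `3`-polytope on one side of a plane that contains
no vertices. -/
theorem IsSimple.card_upper_add_two (hP : P.IsSimple)
    (hc : ∀ v, P.IsVertex v → inner ℝ u v ≠ c)
    (hpos : ∃ v, P.IsVertex v ∧ c < inner ℝ u v) (hneg : ∃ v, P.IsVertex v ∧ inner ℝ u v < c) :
    (P.upper u c).card + 2 =
      (univ.filter fun i => ∃ v ∈ P.verticesOf {i}, c < inner ℝ u v).card +
      (univ.filter fun i => (P.verticesOf {i}).Nonempty ∧
        ∀ v ∈ P.verticesOf {i}, c < inner ℝ u v).card := by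
  -- No vertex lies on the plane, so a small perturbation of `u` moves none of the finitely many
  -- vertices across it.
  have hU : {z | ∀ v ∈ P.verticesOf ∅, (c < inner ℝ z v ↔ c < inner ℝ u v)} ∈ 𝓝 u := by
    refine (eventually_all_finset _).2 fun v hv => ?_
    have ht : Tendsto (fun z => inner ℝ z v) (𝓝 u) (𝓝 (inner ℝ u v)) :=
      Continuous.tendsto (by fun_prop) u
    rcases (hc v (mem_verticesOf.1 hv).1).lt_or_gt with h | h
    · filter_upwards [ht.eventually_lt_const h] with z hz
      exact ⟨fun h' => absurd h' hz.not_gt, fun h' => absurd h' h.not_gt⟩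
    · filter_upwards [ht.eventually_const_lt h] with z hz
      exact ⟨fun _ => h, fun _ => hz⟩
  obtain ⟨z, hz, hgen⟩ := hP.exists_generic hU
  have hz' : ∀ v, P.IsVertex v → (c < inner ℝ z v ↔ c < inner ℝ u v) := fun v hv =>
    hz v (mem_verticesOf.2 ⟨hv, empty_subset _⟩)
  obtain ⟨v, hv, hcv⟩ := hpos
  obtain ⟨w, hw, hcw⟩ := hneg
  have key := hP.card_upper_add_two_of_generic hgen ⟨v, hv, (hz' v hv).2 hcv⟩
    ⟨w, hw, not_lt.1 fun h => hcw.not_gt ((hz' w hw).1 h)⟩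
  convert key using 2
  · congr 1
    ext v
    simp only [mem_upper]
    exact and_congr_right fun hv => (hz' v hv).symm
  · congr 1
    ext i
    simp only [mem_filter, mem_univ, true_and]
    exact exists_congr fun v => and_congr_right fun hv => (hz' v (mem_verticesOf.1 hv).1).symm
  · congr 1
    ext i
    simp only [mem_filter, mem_univ, true_and]
    exact and_congr_right fun _ => forall₂_congr fun v hv => (hz' v (mem_verticesOf.1 hv).1).symm

end Combinatorics

/-! ### Triads and the planes that separate them -/

section Separation

variable {P : ConvexPolytope 3} {x y v w d u q₁ q₂ q₃ : EuclideanSpace ℝ (Fin 3)}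
  {i j k l : Fin P.m} {S T : Finset (Fin P.m)} {c : ℝ}

/-- Three facets that meet pairwise but have no vertex in common. -/
structure IsTriad (P : ConvexPolytope 3) (i j k : Fin P.m) : Prop where
  left : (P.verticesOf {i, j}).Nonempty
  mid : (P.verticesOf {j, k}).Nonempty
  right : (P.verticesOf {k, i}).Nonempty
  not_mem : ∀ v, P.IsVertex v → i ∈ P.active v → j ∈ P.active v → k ∉ P.active v

lemma IsTriad.rotate (h : P.IsTriad i j k) : P.IsTriad j k i :=
  ⟨h.mid, h.right, h.left, fun v hv hj hk hi => h.not_mem v hv hi hj hk⟩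

/-- If `i = j`, a vertex of `j` and `k` would be common to all three; so distinctness need not be
assumed in `IsTriad`. -/
lemma IsTriad.ne (h : P.IsTriad i j k) : i ≠ j := by
  rintro rfl
  obtain ⟨v, hv⟩ := h.mid
  rw [mem_verticesOf_pair] at hv
  exact h.not_mem v hv.1 hv.2.1 hv.2.1 hv.2.2

/-- The plane `⟪u, ·⟫ = c` separates two vertices of the edge in which two facets meet. -/
def CutsEdge (P : ConvexPolytope 3) (u : EuclideanSpace ℝ (Fin 3)) (c : ℝ) (i j : Fin P.m) : Prop :=
  (∃ v ∈ P.verticesOf {i, j}, c < inner ℝ u v) ∧ ∃ v ∈ P.verticesOf {i, j}, inner ℝ u v < c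

/-- The plane `⟪u, ·⟫ = c` contains no vertices, and crosses the facets `i`, `j`, `k` and their
pairwise intersections, but no other facet. -/
structure Separates (P : ConvexPolytope 3) (u : EuclideanSpace ℝ (Fin 3)) (c : ℝ)
    (i j k : Fin P.m) : Prop where
  ne : ∀ v, P.IsVertex v → inner ℝ u v ≠ c
  const : ∀ l, l ≠ i → l ≠ j → l ≠ k → ∀ v ∈ P.verticesOf {l}, ∀ w ∈ P.verticesOf {l},
    c < inner ℝ u v → c < inner ℝ u w
  left : P.CutsEdge u c i j
  mid : P.CutsEdge u c j k
  right : P.CutsEdge u c k i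

lemma Separates.rotate (h : P.Separates u c i j k) : P.Separates u c j k i :=
  ⟨h.ne, fun l hj hk hi => h.const l hi hj hk, h.mid, h.right, h.left⟩

lemma CutsEdge.neg (h : P.CutsEdge u c i j) : P.CutsEdge (-u) (-c) i j := by
  simpa [CutsEdge, and_comm] using h

/-- Lets the lower side be treated as an upper side. The one-sided condition `const` reverses
because no vertex lies on the plane. -/
lemma Separates.neg (h : P.Separates u c i j k) : P.Separates (-u) (-c) i j k where
  ne v hv := by simpa using h.ne v hv
  const l hi hj hk v hv w hw hlt := by
    simp only [inner_neg_left, neg_lt_neg_iff] at hlt ⊢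
    refine lt_of_le_of_ne (not_lt.1 fun h' => ?_) (h.ne w (mem_verticesOf.1 hw).1)
    exact hlt.not_gt (h.const l hi hj hk w hw v hv h')
  left := h.left.neg
  mid := h.mid.neg
  right := h.right.neg

lemma exists_plane {e₁ e₂ : EuclideanSpace ℝ (Fin 3)} (he : LinearIndependent ℝ ![e₁, e₂]) :
    ∃ u : EuclideanSpace ℝ (Fin 3), ∀ x, inner ℝ u x = 0 ↔ ∃ s t : ℝ, s • e₁ + t • e₂ = x := by
  set K := Submodule.span ℝ ({e₁, e₂} : Set (EuclideanSpace ℝ (Fin 3))) with hK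
  have hdim : Module.finrank ℝ K = 2 := by
    have := finrank_span_eq_card he
    rwa [Matrix.range_cons, Matrix.range_cons, Matrix.range_empty, Set.union_empty,
      Set.singleton_union, Fintype.card_fin] at this
  have hadd := K.finrank_add_finrank_orthogonal
  rw [hdim, finrank_euclideanSpace_fin] at hadd
  obtain ⟨⟨u, huK⟩, hu⟩ := (finrank_eq_one_iff' (K := ℝ) (V := Kᗮ)).1 (by omega)
  have hspan : Kᗮ = Submodule.span ℝ {u} := by
    refine le_antisymm (fun x hx => ?_) (by simpa using huK)
    obtain ⟨a, ha⟩ := hu.2 ⟨x, hx⟩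
    exact Submodule.mem_span_singleton.2 ⟨a, congrArg Subtype.val ha⟩
  refine ⟨u, fun x => ?_⟩
  have horth : x ∈ Kᗮᗮ ↔ inner ℝ u x = 0 := by
    rw [hspan, Submodule.mem_orthogonal_singleton_iff_inner_right]
  rw [← Submodule.mem_span_pair, ← hK, ← horth, K.orthogonal_orthogonal]

lemma slack_linear_combination (l : Fin P.m) (r s t : ℝ) (h : r + s + t = 1) :
    P.slack l (r • q₁ + s • q₂ + t • q₃) =
      r * P.slack l q₁ + s * P.slack l q₂ + t * P.slack l q₃ := by
  simp only [slack, inner_add_right, inner_smul_right]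
  linear_combination (-P.b l) * h

/-- The plane through points of the three edges of a triad cuts the polytope in a triangle. -/
lemma IsTriad.exists_plane (h : P.IsTriad i j k) (hq₁ : q₁ ∈ P.carrier) (hq₂ : q₂ ∈ P.carrier)
    (hq₃ : q₃ ∈ P.carrier) (ha₁ : P.active q₁ = {i, j}) (ha₂ : P.active q₂ = {j, k})
    (ha₃ : P.active q₃ = {k, i}) :
    ∃ u c, inner ℝ u q₁ = c ∧ inner ℝ u q₂ = c ∧ inner ℝ u q₃ = c ∧
      ∀ x ∈ P.carrier, inner ℝ u x = c → ∃ r s t : ℝ, 0 ≤ r ∧ 0 ≤ s ∧ 0 ≤ t ∧ r + s + t = 1 ∧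
        x = r • q₁ + s • q₂ + t • q₃ := by
  have hij := h.ne
  have hjk := h.rotate.ne
  have hki := h.rotate.rotate.ne
  have z1 : P.slack i q₁ = 0 := mem_active.1 (by simp [ha₁])
  have z2 : P.slack j q₁ = 0 := mem_active.1 (by simp [ha₁])
  have z3 : P.slack j q₂ = 0 := mem_active.1 (by simp [ha₂])
  have z4 : P.slack k q₂ = 0 := mem_active.1 (by simp [ha₂])
  have z5 : P.slack k q₃ = 0 := mem_active.1 (by simp [ha₃])
  have z6 : P.slack i q₃ = 0 := mem_active.1 (by simp [ha₃])
  have p1 : 0 < P.slack k q₁ := slack_pos_of_notMem hq₁ (by simp [ha₁, hki, hjk.symm])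
  have p2 : 0 < P.slack i q₂ := slack_pos_of_notMem hq₂ (by simp [ha₂, hij, hki.symm])
  have p3 : 0 < P.slack j q₃ := slack_pos_of_notMem hq₃ (by simp [ha₃, hjk, hij.symm])
  have hli : LinearIndependent ℝ ![q₂ - q₁, q₃ - q₁] := by
    rw [LinearIndependent.pair_iff]
    intro s t hst
    have h1 := congrArg (inner ℝ (P.a i)) hst
    have h2 := congrArg (inner ℝ (P.a j)) hst
    simp only [inner_add_right, inner_smul_right, inner_sub_eq_slack_sub, inner_zero_right, z1, z2,
      z3, z6, sub_zero, mul_zero, add_zero, zero_add, mul_eq_zero, p2.ne', p3.ne', or_false]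
      at h1 h2
    exact ⟨h1, h2⟩
  obtain ⟨u, hu⟩ := ConvexPolytope.exists_plane hli
  have h2 := (hu (q₂ - q₁)).2 ⟨1, 0, by simp⟩
  have h3 := (hu (q₃ - q₁)).2 ⟨0, 1, by simp⟩
  rw [inner_sub_right, sub_eq_zero] at h2 h3
  refine ⟨u, _, rfl, h2, h3, fun x hx hux => ?_⟩
  obtain ⟨s, t, hst⟩ := (hu (x - q₁)).1 (by rw [inner_sub_right, hux, sub_self])
  -- Affine coordinates in the triangle. Each of the facets `i`, `j`, `k` contains two of the three
  -- points and has positive slack at the third, so its slack at `x` gives the sign of one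
  -- coordinate.
  have hx' : x = (1 - s - t) • q₁ + s • q₂ + t • q₃ := by
    rw [eq_add_of_sub_eq hst.symm]; module
  have e := fun l => slack_linear_combination (P := P) (q₁ := q₁) (q₂ := q₂) (q₃ := q₃) l
    (1 - s - t) s t (by ring)
  rw [← hx'] at e
  have nn := mem_carrier.1 hx
  have hi := nn i
  have hj := nn j
  have hk := nn k
  rw [e, z1, z6, mul_zero, mul_zero, zero_add, add_zero] at hi
  rw [e, z2, z3, mul_zero, mul_zero, zero_add, zero_add] at hj
  rw [e, z4, z5, mul_zero, mul_zero, add_zero, add_zero] at hk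
  exact ⟨1 - s - t, s, t, nonneg_of_mul_nonneg_left hk p1, nonneg_of_mul_nonneg_left hi p2,
    nonneg_of_mul_nonneg_left hj p3, by ring, hx'⟩

lemma carrier_convex : Convex ℝ P.carrier := by
  intro x hx y hy s t hs ht hst
  refine mem_carrier.2 fun i => ?_
  have := slack_linear_combination (P := P) (q₁ := x) (q₂ := y) (q₃ := 0) i s t 0 (by simpa)
  rw [zero_smul, add_zero, zero_mul, add_zero] at this
  rw [this]
  exact add_nonneg (mul_nonneg hs (mem_carrier.1 hx i)) (mul_nonneg ht (mem_carrier.1 hy i))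

lemma exists_mem_segment_inner_eq (hx : c < inner ℝ u x) (hy : inner ℝ u y < c) :
    ∃ s t : ℝ, 0 < s ∧ 0 < t ∧ s + t = 1 ∧ inner ℝ u (s • x + t • y) = c := by
  have hd : 0 < inner ℝ u x - inner ℝ u y := by linarith
  refine ⟨(c - inner ℝ u y) / (inner ℝ u x - inner ℝ u y),
    (inner ℝ u x - c) / (inner ℝ u x - inner ℝ u y), div_pos (by linarith) hd,
    div_pos (by linarith) hd, ?_, ?_⟩
  · field_simp; ring
  · rw [inner_add_right, inner_smul_right, inner_smul_right]
    field_simp; ring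

/-- Maximising and minimising `u` over the edge gives vertices with values at least and at most `c`;
neither value equals `c`. -/
lemma cutsEdge_of_mem (hc : ∀ v, P.IsVertex v → inner ℝ u v ≠ c) {q : EuclideanSpace ℝ (Fin 3)}
    (hq : q ∈ P.carrier) (ha : P.active q = {i, j}) (hu : inner ℝ u q = c) :
    P.CutsEdge u c i j := by
  obtain ⟨v, hv, hsub, hle⟩ := exists_vertex_ge u hq
  obtain ⟨w, hw, hsub', hle'⟩ := exists_vertex_ge (-u) hq
  simp only [inner_neg_left, neg_le_neg_iff] at hle'
  rw [hu] at hle hle'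
  exact ⟨⟨v, mem_verticesOf.2 ⟨hv, ha ▸ hsub⟩, lt_of_le_of_ne hle (hc v hv).symm⟩,
    ⟨w, mem_verticesOf.2 ⟨hw, ha ▸ hsub'⟩, lt_of_le_of_ne hle' (hc w hw)⟩⟩

/-- A triad is separated by the plane through any three interior points of its edges. If these
points lie strictly above another plane, the separating plane lies above it as well. -/
theorem IsTriad.exists_separates (hP : P.IsSimple) (h : P.IsTriad i j k) (hq₁ : q₁ ∈ P.carrier)
    (hq₂ : q₂ ∈ P.carrier) (hq₃ : q₃ ∈ P.carrier) (ha₁ : P.active q₁ = {i, j})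
    (ha₂ : P.active q₂ = {j, k}) (ha₃ : P.active q₃ = {k, i})
    (h₁ : c < inner ℝ u q₁) (h₂ : c < inner ℝ u q₂) (h₃ : c < inner ℝ u q₃) :
    ∃ u' c', P.Separates u' c' i j k ∧
      ∀ x ∈ P.carrier, inner ℝ u x < c → inner ℝ u' x < c' := by
  obtain ⟨u', c', e₁, e₂, e₃, hplane⟩ := h.exists_plane hq₁ hq₂ hq₃ ha₁ ha₂ ha₃
  -- On the cut, the slack of any other facet is a convex combination of three positive numbers.
  have hact : ∀ x ∈ P.carrier, inner ℝ u' x = c' → ∀ l, l ≠ i → l ≠ j → l ≠ k →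
      0 < P.slack l x := by
    intro x hx hux l hi hj hk
    obtain ⟨r, s, t, hr, hs, ht, hsum, rfl⟩ := hplane x hx hux
    rw [slack_linear_combination l r s t hsum]
    have p1 : 0 < P.slack l q₁ := slack_pos_of_notMem hq₁ (by simp [ha₁, hi, hj])
    have p2 : 0 < P.slack l q₂ := slack_pos_of_notMem hq₂ (by simp [ha₂, hj, hk])
    have p3 : 0 < P.slack l q₃ := slack_pos_of_notMem hq₃ (by simp [ha₃, hk, hi])
    have m1 := mul_nonneg hr p1.le
    have m2 := mul_nonneg hs p2.le
    have m3 := mul_nonneg ht p3.le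
    rcases hr.eq_or_lt with rfl | hr
    · rcases hs.eq_or_lt with rfl | hs
      · have := mul_pos (show 0 < t by linarith) p3
        linarith
      · have := mul_pos hs p2
        linarith
    · have := mul_pos hr p1
      linarith
  have hne : ∀ v, P.IsVertex v → inner ℝ u' v ≠ c' := by
    intro v hv huv
    have hsub : P.active v ⊆ {i, j, k} := by
      intro l hl
      by_contra hn
      simp only [mem_insert, mem_singleton, not_or] at hn
      exact (hact v hv.mem_carrier huv l hn.1 hn.2.1 hn.2.2).ne' (mem_active.1 hl)
    have heq := eq_of_subset_of_card_le hsub (by rw [hP.card_active hv]; exact card_le_three)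
    exact h.not_mem v hv (by simp [heq]) (by simp [heq]) (by simp [heq])
  have hsep : P.Separates u' c' i j k := by
    refine ⟨hne, fun l hi hj hk v hv w hw hlt => ?_, cutsEdge_of_mem hne hq₁ ha₁ e₁,
      cutsEdge_of_mem hne hq₂ ha₂ e₂, cutsEdge_of_mem hne hq₃ ha₃ e₃⟩
    rw [mem_verticesOf_singleton] at hv hw
    refine lt_of_le_of_ne (not_lt.1 fun hgt => ?_) (hne w hw.1).symm
    obtain ⟨s, t, hs, ht, hst, hz⟩ := exists_mem_segment_inner_eq hlt hgt
    have := hact _ (carrier_convex hv.1.mem_carrier hw.1.mem_carrier hs.le ht.le hst) hz l hi hj hk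
    have e := slack_linear_combination (P := P) (q₁ := v) (q₂ := w) (q₃ := 0) l s t 0 (by simpa)
    rw [zero_smul, add_zero, mem_active.1 hv.2, mem_active.1 hw.2] at e
    simp [e] at this
  -- The cut is contained in a triangle lying strictly above the plane of `u` and `c`. So the part
  -- of the polytope below that plane misses the cut and, being convex, lies on one side of it; the
  -- sign of `u'` is chosen accordingly.
  have hoff : ∀ x ∈ P.carrier, inner ℝ u x < c → inner ℝ u' x ≠ c' := by
    intro x hx hux hux'
    obtain ⟨r, s, t, hr, hs, ht, hsum, rfl⟩ := hplane x hx hux'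
    simp only [inner_add_right, inner_smul_right] at hux
    have m1 := mul_le_mul_of_nonneg_left h₁.le hr
    have m2 := mul_le_mul_of_nonneg_left h₂.le hs
    have m3 := mul_le_mul_of_nonneg_left h₃.le ht
    have : (r + s + t) * c = c := by rw [hsum, one_mul]
    linarith
  by_cases hside : ∀ x ∈ P.carrier, inner ℝ u x < c → inner ℝ u' x < c'
  · exact ⟨u', c', hsep, hside⟩
  push Not at hside
  obtain ⟨y, hy, huy, hy'⟩ := hside
  refine ⟨-u', -c', hsep.neg, fun x hx hux => ?_⟩
  rw [inner_neg_left, neg_lt_neg_iff]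
  refine lt_of_le_of_ne (not_lt.1 fun hlt => ?_) (hoff x hx hux).symm
  obtain ⟨s, t, hs, ht, hst, hz⟩ :=
    exists_mem_segment_inner_eq (lt_of_le_of_ne hy' (hoff y hy huy).symm) hlt
  refine hoff _ (carrier_convex hy hx hs.le ht.le hst) ?_ hz
  rw [inner_add_right, inner_smul_right, inner_smul_right]
  have m1 := mul_lt_mul_of_pos_left huy hs
  have m2 := mul_lt_mul_of_pos_left hux ht
  have : (s + t) * c = c := by rw [hst, one_mul]
  linarith

/-- By continuity, points of the edge close enough to `v` are still above the plane. -/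
lemma IsSimple.exists_edge_point_gt (hP : P.IsSimple) (hij : i ≠ j) (hv : v ∈ P.verticesOf {i, j})
    (hu : c < inner ℝ u v) : ∃ q ∈ P.carrier, P.active q = {i, j} ∧ c < inner ℝ u q := by
  rw [mem_verticesOf_pair] at hv
  obtain ⟨k, hki, hkj, hact⟩ := hP.exists_third hv.1 hij hv.2.1 hv.2.2
  have hk : k ∈ P.active v := by simp [hact]
  have ht : Tendsto (fun t : ℝ => inner ℝ u (v + t • P.dir v k)) (𝓝[>] 0)
      (𝓝 (inner ℝ u (v + (0 : ℝ) • P.dir v k))) :=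
    (Continuous.tendsto (by fun_prop) 0).mono_left nhdsWithin_le_nhds
  obtain ⟨t, ⟨hm, ha⟩, hlt⟩ := ((hP.eventually_edge_point hv.1 hk).and
    (ht.eventually_const_lt (by simpa using hu))).exists
  refine ⟨_, hm, ?_, hlt⟩
  rw [ha, hact]
  ext l
  simp only [mem_erase, mem_insert, mem_singleton]
  grind

/-! ### Counting above a separating plane -/

/-- The vertices of the `l`-th facet above the plane `⟪u, ·⟫ = c`. -/
noncomputable def upperOf (P : ConvexPolytope 3) (u : EuclideanSpace ℝ (Fin 3)) (c : ℝ)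
    (l : Fin P.m) : Finset (EuclideanSpace ℝ (Fin 3)) :=
  (P.verticesOf {l}).filter fun v => c < inner ℝ u v

lemma mem_upperOf : v ∈ P.upperOf u c l ↔ P.IsVertex v ∧ l ∈ P.active v ∧ c < inner ℝ u v := by
  simp [upperOf, mem_verticesOf_singleton, and_assoc]

/-- The facets above the plane `⟪u, ·⟫ = c`. -/
noncomputable def above (P : ConvexPolytope 3) (u : EuclideanSpace ℝ (Fin 3)) (c : ℝ) :
    Finset (Fin P.m) :=
  univ.filter fun i => (P.verticesOf {i}).Nonempty ∧ ∀ v ∈ P.verticesOf {i}, c < inner ℝ u v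

lemma mem_above : l ∈ P.above u c ↔
    (P.verticesOf {l}).Nonempty ∧ ∀ v ∈ P.verticesOf {l}, c < inner ℝ u v := by
  simp [above]

lemma Separates.mem_above_of_upper (h : P.Separates u c i j k) (hi : l ≠ i) (hj : l ≠ j)
    (hk : l ≠ k) (hv : P.IsVertex v) (hl : l ∈ P.active v) (hu : c < inner ℝ u v) :
    l ∈ P.above u c := by
  have hvl := mem_verticesOf_singleton.2 ⟨hv, hl⟩
  exact mem_above.2 ⟨⟨v, hvl⟩, fun w hw => h.const l hi hj hk v hvl w hw hu⟩

lemma CutsEdge.notMem_above (h : P.CutsEdge u c i j) : i ∉ P.above u c := fun hi => by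
  obtain ⟨v, hv, hlt⟩ := h.2
  rw [mem_verticesOf_pair] at hv
  exact hlt.not_gt ((mem_above.1 hi).2 v (mem_verticesOf_singleton.2 ⟨hv.1, hv.2.1⟩))

lemma CutsEdge.eq_of_upper (hP : P.IsSimple) (h : P.CutsEdge u c i j) (hij : i ≠ j)
    (hv : v ∈ P.verticesOf {i, j}) (hw : w ∈ P.verticesOf {i, j}) (huv : c < inner ℝ u v)
    (huw : c < inner ℝ u w) : v = w := by
  obtain ⟨z, hz, hlt⟩ := h.2
  by_contra hne
  have : 2 < (P.verticesOf {i, j}).card :=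
    two_lt_card.2 ⟨v, hv, w, hw, z, hz, hne, fun e => hlt.not_gt (e ▸ huv),
      fun e => hlt.not_gt (e ▸ huw)⟩
  rw [hP.card_verticesOf_pair hij ⟨v, hv⟩] at this
  exact this.false

/-- The curvature count for the part of a simple `3`-polytope above a separating plane. -/
theorem Separates.sum_card_above (hP : P.IsSimple) (ht : P.IsTriad i j k)
    (h : P.Separates u c i j k) :
    ∑ l ∈ P.above u c, (P.verticesOf {l}).card + ((P.upperOf u c i).card +
      (P.upperOf u c j).card + (P.upperOf u c k).card) = 6 * (P.above u c).card + 3 := by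
  have hij := ht.ne
  have hjk := ht.rotate.ne
  have hki := ht.rotate.rotate.ne
  have hsome : (univ.filter fun l => ∃ v ∈ P.verticesOf {l}, c < inner ℝ u v) =
      P.above u c ∪ {i, j, k} := by
    ext l
    simp only [mem_filter, mem_univ, true_and, mem_union]
    constructor
    · rintro ⟨v, hv, hlt⟩
      by_cases hl : l ∈ ({i, j, k} : Finset _)
      · exact Or.inr hl
      · simp only [mem_insert, mem_singleton, not_or] at hl
        rw [mem_verticesOf_singleton] at hv
        exact Or.inl (h.mem_above_of_upper hl.1 hl.2.1 hl.2.2 hv.1 hv.2 hlt)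
    · rintro (hl | hl)
      · obtain ⟨⟨v, hv⟩, hall⟩ := mem_above.1 hl
        exact ⟨v, hv, hall v hv⟩
      · have hc : ∀ {a b}, P.CutsEdge u c a b → ∃ v ∈ P.verticesOf {a}, c < inner ℝ u v := by
          rintro a b ⟨⟨v, hv, hlt⟩, -⟩
          rw [mem_verticesOf_pair] at hv
          exact ⟨v, mem_verticesOf_singleton.2 ⟨hv.1, hv.2.1⟩, hlt⟩
        simp only [mem_insert, mem_singleton] at hl
        rcases hl with rfl | rfl | rfl
        exacts [hc h.left, hc h.mid, hc h.right]
  have hdisj : Disjoint (P.above u c) {i, j, k} := by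
    rw [disjoint_right]
    intro l hl
    simp only [mem_insert, mem_singleton] at hl
    rcases hl with rfl | rfl | rfl
    exacts [h.left.notMem_above, h.mid.notMem_above, h.right.notMem_above]
  have heuler := hP.card_upper_add_two h.ne
    (let ⟨v, hv, hlt⟩ := h.left.1; ⟨v, (mem_verticesOf.1 hv).1, hlt⟩)
    (let ⟨v, hv, hlt⟩ := h.left.2; ⟨v, (mem_verticesOf.1 hv).1, hlt⟩)
  rw [hsome, card_union_of_disjoint hdisj, card_eq_three.2 ⟨i, j, k, hij, hki.symm, hjk, rfl⟩]
    at heuler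
  -- With V upper vertices and N facets above, Euler's relation reads V + 2 = 2N + 3, so the 3V
  -- incidences of upper vertices with facets number 6N + 3.
  have hcount := sum_card_bipartiteAbove_eq_sum_card_bipartiteBelow (s := univ)
    (t := P.upper u c) fun l v => l ∈ P.active v
  have hl : ∀ l, bipartiteAbove (fun l v => l ∈ P.active v) (P.upper u c) l = P.upperOf u c l := by
    intro l
    ext v
    simp only [mem_bipartiteAbove, mem_upper, mem_upperOf]
    tauto
  have hr : ∀ v ∈ P.upper u c,
      (bipartiteBelow (fun l v => l ∈ P.active v) univ v).card = 3 := by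
    intro v hv
    rw [mem_upper] at hv
    exact Eq.trans (by congr 1; ext l; simp) (hP.card_active hv.1)
  rw [sum_congr rfl hr, sum_const, smul_eq_mul, sum_congr rfl fun l _ => by rw [hl l],
    ← sum_subset (subset_univ (P.above u c ∪ {i, j, k})), sum_union hdisj,
    sum_insert (by simp [hij, hki.symm]), sum_pair hjk] at hcount
  · have : ∀ l ∈ P.above u c, (P.upperOf u c l).card = (P.verticesOf {l}).card := fun l hl => by
      rw [upperOf, filter_true_of_mem (mem_above.1 hl).2]
    rw [sum_congr rfl this] at hcount
    change (P.upper u c).card + 2 = (P.above u c).card + 3 + (P.above u c).card at heuler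
    omega
  · intro l _ hl
    rw [← hsome] at hl
    simp only [mem_filter, mem_univ, true_and, not_exists, not_and] at hl
    exact card_eq_zero.2 (filter_eq_empty_iff.2 hl)

end Separation

/-! ### Replacing a triad by one further up, and the curvature bound -/

section Descent

variable {P : ConvexPolytope 3} {v w u a b t q₁ q₂ q₃ : EuclideanSpace ℝ (Fin 3)}
  {i j k l i' j' k' X Y Z : Fin P.m} {S T : Finset (Fin P.m)} {c : ℝ}

lemma IsSimple.verticesOf_pair_eq (hP : P.IsSimple) (hij : i ≠ j) (ha : a ∈ P.verticesOf {i, j})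
    (hb : b ∈ P.verticesOf {i, j}) (hab : a ≠ b) : P.verticesOf {i, j} = {a, b} := by
  refine (eq_of_subset_of_card_le (by simp [insert_subset_iff, ha, hb]) ?_).symm
  rw [hP.card_verticesOf_pair hij ⟨a, ha⟩, card_pair hab]

lemma mem_verticesOf_triple :
    v ∈ P.verticesOf {i, j, k} ↔ P.IsVertex v ∧ i ∈ P.active v ∧ j ∈ P.active v ∧
      k ∈ P.active v := by
  simp [mem_verticesOf, insert_subset_iff]

lemma IsSimple.active_eq (hP : P.IsSimple) (hij : i ≠ j) (hik : i ≠ k) (hjk : j ≠ k)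
    (hv : v ∈ P.verticesOf {i, j, k}) : P.active v = {i, j, k} := by
  obtain ⟨hv, hi, hj, hk⟩ := mem_verticesOf_triple.1 hv
  exact hP.eq_insert_of_mem hv hij hik hjk hi hj hk

/-- A facet whose neighbours `i`, `j`, `k` meet it in a closed chain is a triangle. -/
lemma IsSimple.card_verticesOf_eq_three (hP : P.IsSimple) (hi : X ≠ i) (hj : X ≠ j) (hk : X ≠ k)
    (hij : i ≠ j) (hjk : j ≠ k) (hki : k ≠ i) (ha : a ∈ P.verticesOf {X, i, j})
    (hb : b ∈ P.verticesOf {X, j, k}) (ht : t ∈ P.verticesOf {X, k, i}) :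
    (P.verticesOf {X}).card = 3 := by
  have ea := hP.active_eq hi hj hij ha
  have eb := hP.active_eq hj hk hjk hb
  have et := hP.active_eq hk hi hki ht
  rw [mem_verticesOf] at ha hb ht
  have hab : a ≠ b := fun e => by
    have : i ∈ P.active b := e ▸ by simp [ea]
    simp [eb, hi.symm, hij, hki.symm] at this
  have hbt : b ≠ t := fun e => by
    have : j ∈ P.active t := e ▸ by simp [eb]
    simp [et, hj.symm, hjk, hij.symm] at this
  have hta : t ≠ a := fun e => by
    have : k ∈ P.active a := e ▸ by simp [et]
    simp [ea, hk.symm, hki, hjk.symm] at this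
  have mem : ∀ {v l}, P.IsVertex v → X ∈ P.active v → l ∈ P.active v → v ∈ P.verticesOf {X, l} :=
    fun hv hX hl => mem_verticesOf_pair.2 ⟨hv, hX, hl⟩
  have vi : P.verticesOf {X, i} = {t, a} := hP.verticesOf_pair_eq hi
    (mem ht.1 (by simp [et]) (by simp [et])) (mem ha.1 (by simp [ea]) (by simp [ea])) hta
  have vj : P.verticesOf {X, j} = {a, b} := hP.verticesOf_pair_eq hj
    (mem ha.1 (by simp [ea]) (by simp [ea])) (mem hb.1 (by simp [eb]) (by simp [eb])) hab
  have vk : P.verticesOf {X, k} = {b, t} := hP.verticesOf_pair_eq hk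
    (mem hb.1 (by simp [eb]) (by simp [eb])) (mem ht.1 (by simp [et]) (by simp [et])) hbt
  -- The edges of `X` at these vertices have both ends among them, so `mem_of_closed` makes them all
  -- the vertices of `X`.
  rw [← hP.mem_of_closed (T := {a, b, t})]
  · exact card_eq_three.2 ⟨a, b, t, hab, hta.symm, hbt, rfl⟩
  · simp [insert_subset_iff, mem_verticesOf_singleton, ha.1, hb.1, ht.1, ea, eb, et]
  · simp
  · simp only [mem_insert, mem_singleton]
    rintro v (rfl | rfl | rfl) l hl hlX <;>
      simp only [ea, eb, et, mem_insert, mem_singleton, hlX, false_or] at hl <;>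
      rcases hl with rfl | rfl <;> simp [vi, vj, vk, insert_subset_iff]

/-- A facet whose neighbours `i`, `j`, `k`, `l` meet it in a closed chain is a quadrangle. -/
lemma IsSimple.card_verticesOf_eq_four (hP : P.IsSimple) (hi : X ≠ i) (hj : X ≠ j) (hk : X ≠ k)
    (hl : X ≠ l) (hij : i ≠ j) (hjk : j ≠ k) (hkl : k ≠ l) (hli : l ≠ i) (hik : i ≠ k)
    (hjl : j ≠ l) (ha : a ∈ P.verticesOf {X, i, j}) (hb : b ∈ P.verticesOf {X, j, k})
    (ht : t ∈ P.verticesOf {X, k, l}) (hw : w ∈ P.verticesOf {X, l, i}) :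
    (P.verticesOf {X}).card = 4 := by
  have ea := hP.active_eq hi hj hij ha
  have eb := hP.active_eq hj hk hjk hb
  have et := hP.active_eq hk hl hkl ht
  have ew := hP.active_eq hl hi hli hw
  rw [mem_verticesOf] at ha hb ht hw
  have hab : a ≠ b := fun e => by
    have : i ∈ P.active b := e ▸ by simp [ea]
    simp [eb, hi.symm, hij, hik] at this
  have hat : a ≠ t := fun e => by
    have : i ∈ P.active t := e ▸ by simp [ea]
    simp [et, hi.symm, hik, hli.symm] at this
  have hbt : b ≠ t := fun e => by
    have : j ∈ P.active t := e ▸ by simp [eb]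
    simp [et, hj.symm, hjk, hjl] at this
  have hbw : b ≠ w := fun e => by
    have : j ∈ P.active w := e ▸ by simp [eb]
    simp [ew, hj.symm, hjl, hij.symm] at this
  have htw : t ≠ w := fun e => by
    have : k ∈ P.active w := e ▸ by simp [et]
    simp [ew, hk.symm, hkl, hik.symm] at this
  have hwa : w ≠ a := fun e => by
    have : l ∈ P.active a := e ▸ by simp [ew]
    simp [ea, hl.symm, hli, hjl.symm] at this
  have mem : ∀ {v l}, P.IsVertex v → X ∈ P.active v → l ∈ P.active v → v ∈ P.verticesOf {X, l} :=
    fun hv hX hl => mem_verticesOf_pair.2 ⟨hv, hX, hl⟩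
  have vi : P.verticesOf {X, i} = {w, a} := hP.verticesOf_pair_eq hi
    (mem hw.1 (by simp [ew]) (by simp [ew])) (mem ha.1 (by simp [ea]) (by simp [ea])) hwa
  have vj : P.verticesOf {X, j} = {a, b} := hP.verticesOf_pair_eq hj
    (mem ha.1 (by simp [ea]) (by simp [ea])) (mem hb.1 (by simp [eb]) (by simp [eb])) hab
  have vk : P.verticesOf {X, k} = {b, t} := hP.verticesOf_pair_eq hk
    (mem hb.1 (by simp [eb]) (by simp [eb])) (mem ht.1 (by simp [et]) (by simp [et])) hbt
  have vl : P.verticesOf {X, l} = {t, w} := hP.verticesOf_pair_eq hl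
    (mem ht.1 (by simp [et]) (by simp [et])) (mem hw.1 (by simp [ew]) (by simp [ew])) htw
  rw [← hP.mem_of_closed (T := {a, b, t, w})]
  · rw [card_insert_of_notMem (by simp [hab, hat, hwa.symm]),
      card_eq_three.2 ⟨b, t, w, hbt, hbw, htw, rfl⟩]
  · simp [insert_subset_iff, mem_verticesOf_singleton, ha.1, hb.1, ht.1, hw.1, ea, eb, et, ew]
  · simp
  · simp only [mem_insert, mem_singleton]
    rintro v (rfl | rfl | rfl | rfl) l hl hlX <;>
      simp only [ea, eb, et, ew, mem_insert, mem_singleton, hlX, false_or] at hl <;>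
      rcases hl with rfl | rfl <;> simp [vi, vj, vk, vl, insert_subset_iff]

/-- A triad with an edge point above the plane on each of its edges, one of whose facets lies above
the plane, has a separating plane with fewer facets above it. -/
lemma Separates.exists_above_ssubset (hP : P.IsSimple) (h : P.Separates u c i j k)
    (ht : P.IsTriad i' j' k') (hi' : i' ∈ P.above u c)
    (h₁ : ∃ v ∈ P.verticesOf {i', j'}, c < inner ℝ u v)
    (h₂ : ∃ v ∈ P.verticesOf {j', k'}, c < inner ℝ u v)
    (h₃ : ∃ v ∈ P.verticesOf {k', i'}, c < inner ℝ u v) :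
    ∃ u' c', P.Separates u' c' i' j' k' ∧ P.above u' c' ⊂ P.above u c := by
  obtain ⟨v₁, hv₁, hu₁⟩ := h₁
  obtain ⟨v₂, hv₂, hu₂⟩ := h₂
  obtain ⟨v₃, hv₃, hu₃⟩ := h₃
  obtain ⟨q₁, hq₁, ha₁, hc₁⟩ := hP.exists_edge_point_gt ht.ne hv₁ hu₁
  obtain ⟨q₂, hq₂, ha₂, hc₂⟩ := hP.exists_edge_point_gt ht.rotate.ne hv₂ hu₂
  obtain ⟨q₃, hq₃, ha₃, hc₃⟩ := hP.exists_edge_point_gt ht.rotate.rotate.ne hv₃ hu₃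
  obtain ⟨u', c', hsep, hside⟩ :=
    ht.exists_separates hP hq₁ hq₂ hq₃ ha₁ ha₂ ha₃ hc₁ hc₂ hc₃
  -- The vertices below the old plane are below the new one, so no facet is gained; `i'` is lost,
  -- because the new plane crosses it.
  refine ⟨u', c', hsep, (Finset.ssubset_iff_of_subset fun l hl => ?_).2
    ⟨i', hi', hsep.left.notMem_above⟩⟩
  rw [mem_above] at hl ⊢
  refine ⟨hl.1, fun v hv => not_le.1 fun hle => (hl.2 v hv).not_gt ?_⟩
  have hv' := (mem_verticesOf.1 hv).1
  exact hside v hv'.mem_carrier (lt_of_le_of_ne hle (h.ne v hv'))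

/-- The upper ends of the edges with `j` and with `k` are distinct, as the triad has no common
vertex. -/
lemma Separates.one_lt_card_upperOf (ht : P.IsTriad i j k) (h : P.Separates u c i j k) :
    1 < (P.upperOf u c i).card := by
  obtain ⟨a, ha, hua⟩ := h.left.1
  obtain ⟨b, hb, hub⟩ := h.right.1
  rw [mem_verticesOf_pair] at ha hb
  refine one_lt_card.2 ⟨a, mem_upperOf.2 ⟨ha.1, ha.2.1, hua⟩, b,
    mem_upperOf.2 ⟨hb.1, hb.2.2, hub⟩, ?_⟩
  rintro rfl
  exact ht.not_mem a ha.1 ha.2.1 ha.2.2 hb.2.1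

/-- If only one edge of the facet `i` lies above the separating plane, then the facet behind this
edge can replace `i` in the triad. -/
lemma Separates.exists_above_ssubset_of_card_eq_two (hP : P.IsSimple)
    (h3 : ∀ l, (P.verticesOf {l}).card ≠ 3) (ht : P.IsTriad i j k) (h : P.Separates u c i j k)
    (hcard : (P.upperOf u c i).card = 2) :
    ∃ u' c' i' j' k', P.IsTriad i' j' k' ∧ P.Separates u' c' i' j' k' ∧
      P.above u' c' ⊂ P.above u c := by
  have hij := ht.ne
  have hjk := ht.rotate.ne
  have hki := ht.rotate.rotate.ne
  obtain ⟨a, ha, hua⟩ := h.left.1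
  obtain ⟨b, hb, hub⟩ := h.right.1
  have ha' := mem_verticesOf_pair.1 ha
  have hb' := mem_verticesOf_pair.1 hb
  have hab : a ≠ b := by
    rintro rfl
    exact ht.not_mem a ha'.1 ha'.2.1 ha'.2.2 hb'.2.1
  have hup : P.upperOf u c i = {a, b} := by
    refine (eq_of_subset_of_card_le ?_ (by rw [hcard, card_pair hab])).symm
    simp [insert_subset_iff, mem_upperOf, ha', hb', hua, hub]
  obtain ⟨X, hXi, hXj, hact⟩ := hP.exists_third ha'.1 hij ha'.2.1 ha'.2.2
  have hXa : X ∈ P.active a := by simp [hact]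
  have hXk : X ≠ k := by
    rintro rfl
    exact ht.not_mem a ha'.1 ha'.2.1 ha'.2.2 hXa
  have hX := h.mem_above_of_upper hXi hXj hXk ha'.1 hXa hua
  have hXup : ∀ v, P.IsVertex v → X ∈ P.active v → c < inner ℝ u v := fun v hv hXv =>
    (mem_above.1 hX).2 v (mem_verticesOf_singleton.2 ⟨hv, hXv⟩)
  -- `X` lies wholly above, so the other end of its edge with `i` is an upper vertex of `i`, and
  -- only `b` is left.
  have hXb : X ∈ P.active b := by
    have h2 := hP.card_verticesOf_pair hXi.symm
      ⟨a, mem_verticesOf_pair.2 ⟨ha'.1, ha'.2.1, hXa⟩⟩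
    obtain ⟨w, hw, hwa⟩ := exists_mem_ne (h2 ▸ one_lt_two) a
    rw [mem_verticesOf_pair] at hw
    have : w ∈ P.upperOf u c i := mem_upperOf.2 ⟨hw.1, hw.2.1, hXup w hw.1 hw.2.2⟩
    rw [hup, mem_insert, mem_singleton] at this
    exact this.resolve_left hwa ▸ hw.2.2
  have haX : a ∈ P.verticesOf {X, j} := mem_verticesOf_pair.2 ⟨ha'.1, hXa, ha'.2.2⟩
  have hbX : b ∈ P.verticesOf {k, X} := mem_verticesOf_pair.2 ⟨hb'.1, hb'.2.1, hXb⟩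
  have htriad : P.IsTriad X j k := by
    refine ⟨⟨a, haX⟩, ht.mid, ⟨b, hbX⟩, fun t htv htX htj htk => ?_⟩
    -- A common vertex would close the chain `i`, `j`, `k` around `X`, making it a triangle.
    exact h3 X (hP.card_verticesOf_eq_three hXi hXj hXk hij hjk hki
      (mem_verticesOf_triple.2 ⟨ha'.1, hXa, ha'.2⟩)
      (mem_verticesOf_triple.2 ⟨htv, htX, htj, htk⟩)
      (mem_verticesOf_triple.2 ⟨hb'.1, hXb, hb'.2⟩))
  obtain ⟨u', c', hsep, hss⟩ := h.exists_above_ssubset hP htriad hX ⟨a, haX, hua⟩ h.mid.1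
    ⟨b, hbX, hub⟩
  exact ⟨u', c', X, j, k, htriad, hsep, hss⟩

/-- If two edges of the facet `i` lie above the separating plane, then the facets behind them
differ and meet at a vertex of `i`. -/
lemma Separates.exists_common_vertex (hP : P.IsSimple) (ht : P.IsTriad i j k)
    (h : P.Separates u c i j k) (hcard : (P.upperOf u c i).card = 3)
    (ha : a ∈ P.verticesOf {i, j, X}) (hua : c < inner ℝ u a) (hXi : X ≠ i) (hXj : X ≠ j)
    (hb : b ∈ P.verticesOf {k, i, Z}) (hub : c < inner ℝ u b) (hZk : Z ≠ k) (hZi : Z ≠ i) :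
    X ≠ Z ∧ ∃ w ∈ P.verticesOf {i, X, Z}, c < inner ℝ u w := by
  have hij := ht.ne
  have hjk := ht.rotate.ne
  have hki := ht.rotate.rotate.ne
  have ea := hP.active_eq hij hXi.symm hXj.symm ha
  have eb := hP.active_eq hki hZk.symm hZi.symm hb
  rw [mem_verticesOf_triple] at ha hb
  have hab : a ≠ b := by
    rintro rfl
    exact ht.not_mem a ha.1 ha.2.1 ha.2.2.1 hb.2.1
  obtain ⟨w, hw, hwab⟩ := exists_mem_notMem_of_card_lt_card (s := {a, b})
    (t := P.upperOf u c i) (by rw [hcard, card_pair hab]; norm_num)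
  simp only [mem_insert, mem_singleton, not_or] at hwab
  have hup : P.upperOf u c i = {a, b, w} := by
    refine (eq_of_subset_of_card_le ?_ ?_).symm
    · simp [insert_subset_iff, mem_upperOf.2 ⟨ha.1, ha.2.1, hua⟩,
        mem_upperOf.2 ⟨hb.1, hb.2.2.1, hub⟩, hw]
    · rw [hcard, card_eq_three.2 ⟨a, b, w, hab, Ne.symm hwab.1, Ne.symm hwab.2, rfl⟩]
  rw [mem_upperOf] at hw
  -- `D` is neither `j` nor `k`, whose edges with `i` have only one upper end each. So `D` lies
  -- wholly above, and its edge with `i` runs from `w` to `a` or `b`, where the third facet is `X`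
  -- or `Z`.
  have key : ∀ D ∈ P.active w, D ≠ i → D = X ∨ D = Z := by
    intro D hD hDi
    have hDj : D ≠ j := by
      rintro rfl
      exact hwab.1 (h.left.eq_of_upper hP hij (mem_verticesOf_pair.2 ⟨hw.1, hw.2.1, hD⟩)
        (mem_verticesOf_pair.2 ⟨ha.1, ha.2.1, ha.2.2.1⟩) hw.2.2 hua)
    have hDk : D ≠ k := by
      rintro rfl
      exact hwab.2 (h.right.eq_of_upper hP hki (mem_verticesOf_pair.2 ⟨hw.1, hD, hw.2.1⟩)
        (mem_verticesOf_pair.2 ⟨hb.1, hb.2.1, hb.2.2.1⟩) hw.2.2 hub)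
    have hDup := (mem_above.1 (h.mem_above_of_upper hDi hDj hDk hw.1 hD hw.2.2)).2
    have h2 := hP.card_verticesOf_pair hDi.symm
      ⟨w, mem_verticesOf_pair.2 ⟨hw.1, hw.2.1, hD⟩⟩
    obtain ⟨p, hp, hpw⟩ := exists_mem_ne (h2 ▸ one_lt_two) w
    rw [mem_verticesOf_pair] at hp
    have hpu : p ∈ P.upperOf u c i := mem_upperOf.2
      ⟨hp.1, hp.2.1, hDup p (mem_verticesOf_singleton.2 ⟨hp.1, hp.2.2⟩)⟩
    simp only [hup, mem_insert, mem_singleton, hpw, or_false] at hpu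
    rcases hpu with rfl | rfl
    · have := hp.2.2
      simp only [ea, mem_insert, mem_singleton, hDi, hDj, false_or] at this
      exact Or.inl this
    · have := hp.2.2
      simp only [eb, mem_insert, mem_singleton, hDi, hDk, false_or] at this
      exact Or.inr this
  have hcw : ((P.active w).erase i).card = 2 := by
    rw [card_erase_of_mem hw.2.1, hP.card_active hw.1]
  obtain ⟨D, E, hDE, hpair⟩ := card_eq_two.1 hcw
  have hD : D ∈ (P.active w).erase i := by simp [hpair]
  have hE : E ∈ (P.active w).erase i := by simp [hpair]
  rw [mem_erase] at hD hE
  have : ({X, Z} : Finset (Fin P.m)) = {D, E} ∧ X ≠ Z := by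
    rcases key D hD.2 hD.1 with rfl | rfl <;> rcases key E hE.2 hE.1 with rfl | rfl
    exacts [absurd rfl hDE, ⟨rfl, hDE⟩, ⟨pair_comm _ _, hDE.symm⟩, absurd rfl hDE]
  have hX : X ∈ (P.active w).erase i := by rw [hpair, ← this.1]; simp
  have hZ : Z ∈ (P.active w).erase i := by rw [hpair, ← this.1]; simp
  exact ⟨this.2, w, mem_verticesOf_triple.2
    ⟨hw.1, hw.2.1, (mem_erase.1 hX).2, (mem_erase.1 hZ).2⟩, hw.2.2⟩

/-- If exactly two edges of each facet of the triad lie above the separating plane, then the facets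
behind these edges form a triad. -/
lemma Separates.exists_above_ssubset_of_card_eq_three (hP : P.IsSimple)
    (h4 : (univ.filter fun l => (P.verticesOf {l}).card = 4).card ≤ 2) (ht : P.IsTriad i j k)
    (h : P.Separates u c i j k) (hi : (P.upperOf u c i).card = 3)
    (hj : (P.upperOf u c j).card = 3) (hk : (P.upperOf u c k).card = 3) :
    ∃ u' c' i' j' k', P.IsTriad i' j' k' ∧ P.Separates u' c' i' j' k' ∧
      P.above u' c' ⊂ P.above u c := by
  have hij := ht.ne
  have hjk := ht.rotate.ne
  have hki := ht.rotate.rotate.ne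
  have third : ∀ {i j k}, P.IsTriad i j k → P.Separates u c i j k →
      ∃ a X, X ≠ i ∧ X ≠ j ∧ X ≠ k ∧ a ∈ P.verticesOf {i, j, X} ∧ c < inner ℝ u a := by
    intro i j k ht h
    obtain ⟨a, ha, hua⟩ := h.left.1
    rw [mem_verticesOf_pair] at ha
    obtain ⟨X, hXi, hXj, hact⟩ := hP.exists_third ha.1 ht.ne ha.2.1 ha.2.2
    refine ⟨a, X, hXi, hXj, ?_, mem_verticesOf.2 ⟨ha.1, hact.ge⟩, hua⟩
    rintro rfl
    exact ht.not_mem a ha.1 ha.2.1 ha.2.2 (by simp [hact])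
  obtain ⟨a, X, hXi, hXj, hXk, ha, hua⟩ := third ht h
  obtain ⟨b, Y, hYj, hYk, hYi, hb, hub⟩ := third ht.rotate h.rotate
  obtain ⟨t, Z, hZk, hZi, hZj, hc, huc⟩ := third ht.rotate.rotate h.rotate.rotate
  obtain ⟨hXZ, w₁, hw₁, hu₁⟩ := h.exists_common_vertex hP ht hi ha hua hXi hXj hc huc hZk hZi
  obtain ⟨hYX, w₂, hw₂, hu₂⟩ :=
    h.rotate.exists_common_vertex hP ht.rotate hj hb hub hYj hYk ha hua hXi hXj
  obtain ⟨hZY, w₃, hw₃, hu₃⟩ :=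
    h.rotate.rotate.exists_common_vertex hP ht.rotate.rotate hk hc huc hZk hZi hb hub hYj hYk
  rw [mem_verticesOf_triple] at ha hb hc hw₁ hw₂ hw₃
  have m₁ : w₂ ∈ P.verticesOf {X, Y} := mem_verticesOf_pair.2 ⟨hw₂.1, hw₂.2.2.2, hw₂.2.2.1⟩
  have m₂ : w₃ ∈ P.verticesOf {Y, Z} := mem_verticesOf_pair.2 ⟨hw₃.1, hw₃.2.2.2, hw₃.2.2.1⟩
  have m₃ : w₁ ∈ P.verticesOf {Z, X} := mem_verticesOf_pair.2 ⟨hw₁.1, hw₁.2.2.2, hw₁.2.2.1⟩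
  have hX := h.mem_above_of_upper hXi hXj hXk ha.1 ha.2.2.2 hua
  have htriad : P.IsTriad X Y Z := by
    refine ⟨⟨w₂, m₁⟩, ⟨w₃, m₂⟩, ⟨w₁, m₃⟩, fun p hp hpX hpY hpZ => ?_⟩
    -- A common vertex `p` would surround `X` by `i`, `j`, `Y`, `Z`, and symmetrically for `Y` and
    -- `Z`: three quadrangles, one too many.
    have qX := hP.card_verticesOf_eq_four hXi hXj hYX.symm hXZ hij hYj.symm hZY.symm hZi hYi.symm
      hZj.symm (mem_verticesOf_triple.2 ⟨ha.1, ha.2.2.2, ha.2.1, ha.2.2.1⟩)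
      (mem_verticesOf_triple.2 ⟨hw₂.1, hw₂.2.2.2, hw₂.2.1, hw₂.2.2.1⟩)
      (mem_verticesOf_triple.2 ⟨hp, hpX, hpY, hpZ⟩)
      (mem_verticesOf_triple.2 ⟨hw₁.1, hw₁.2.2.1, hw₁.2.2.2, hw₁.2.1⟩)
    have qY := hP.card_verticesOf_eq_four hYj hYk hZY.symm hYX hjk hZk.symm hXZ.symm hXj hZj.symm
      hXk.symm (mem_verticesOf_triple.2 ⟨hb.1, hb.2.2.2, hb.2.1, hb.2.2.1⟩)
      (mem_verticesOf_triple.2 ⟨hw₃.1, hw₃.2.2.2, hw₃.2.1, hw₃.2.2.1⟩)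
      (mem_verticesOf_triple.2 ⟨hp, hpY, hpZ, hpX⟩)
      (mem_verticesOf_triple.2 ⟨hw₂.1, hw₂.2.2.1, hw₂.2.2.2, hw₂.2.1⟩)
    have qZ := hP.card_verticesOf_eq_four hZk hZi hXZ.symm hZY hki hXi.symm hYX.symm hYk hXk.symm
      hYi.symm (mem_verticesOf_triple.2 ⟨hc.1, hc.2.2.2, hc.2.1, hc.2.2.1⟩)
      (mem_verticesOf_triple.2 ⟨hw₁.1, hw₁.2.2.2, hw₁.2.1, hw₁.2.2.1⟩)
      (mem_verticesOf_triple.2 ⟨hp, hpZ, hpX, hpY⟩)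
      (mem_verticesOf_triple.2 ⟨hw₃.1, hw₃.2.2.1, hw₃.2.2.2, hw₃.2.1⟩)
    refine absurd (two_lt_card.2 ⟨X, ?_, Y, ?_, Z, ?_, hYX.symm, hXZ, hZY.symm⟩) h4.not_gt <;>
      simpa
  obtain ⟨u', c', hsep, hss⟩ := h.exists_above_ssubset hP htriad hX ⟨w₂, m₁, hu₂⟩ ⟨w₃, m₂, hu₃⟩
    ⟨w₁, m₃, hu₁⟩
  exact ⟨u', c', X, Y, Z, htriad, hsep, hss⟩

/-- The total curvature `6 - k` of the `k`-gons with `k < 6` above a plane. -/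
noncomputable def curvature (P : ConvexPolytope 3) (u : EuclideanSpace ℝ (Fin 3)) (c : ℝ) : ℕ :=
  ∑ l ∈ P.above u c, (6 - (P.verticesOf {l}).card)

/-- Truncated subtraction splits 6 - k into its positive part, the curvature, and its negative part,
the excess k - 6 of large facets. -/
lemma Separates.curvature_add_three (hP : P.IsSimple) (ht : P.IsTriad i j k)
    (h : P.Separates u c i j k) :
    P.curvature u c + 3 = (P.upperOf u c i).card + (P.upperOf u c j).card +
      (P.upperOf u c k).card + ∑ l ∈ P.above u c, ((P.verticesOf {l}).card - 6) := by
  have h1 := h.sum_card_above hP ht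
  have h2 : P.curvature u c + ∑ l ∈ P.above u c, (P.verticesOf {l}).card =
      6 * (P.above u c).card + ∑ l ∈ P.above u c, ((P.verticesOf {l}).card - 6) := by
    rw [curvature, ← sum_add_distrib, mul_comm, ← smul_eq_mul, ← sum_const, ← sum_add_distrib]
    exact sum_congr rfl fun l _ => by omega
  omega

/-- Curvature at most 6 bounds the three counts of upper vertices by 9 in total; each is at least 2,
so one is 2 or all are 3, and both cases descend. The bound is inherited because the new set of
facets above is a subset of the old one. -/
theorem Separates.six_lt_curvature (hP : P.IsSimple)
    (h3 : ∀ l, (P.verticesOf {l}).card ≠ 3)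
    (h4 : (univ.filter fun l => (P.verticesOf {l}).card = 4).card ≤ 2) (ht : P.IsTriad i j k)
    (h : P.Separates u c i j k) : 6 < P.curvature u c := by
  by_contra! hcurv
  induction hN : (P.above u c).card using Nat.strong_induction_on generalizing u c i j k with
  | _ N ih =>
  have descend : ¬∃ u' c' i' j' k', P.IsTriad i' j' k' ∧ P.Separates u' c' i' j' k' ∧
      P.above u' c' ⊂ P.above u c := by
    rintro ⟨u', c', i', j', k', ht', hsep, hss⟩
    exact ih _ (hN ▸ card_lt_card hss) ht' hsep
      ((sum_le_sum_of_subset hss.1).trans hcurv) rfl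
  have hsum := h.curvature_add_three hP ht
  have hi := h.one_lt_card_upperOf ht
  have hj := h.rotate.one_lt_card_upperOf ht.rotate
  have hk := h.rotate.rotate.one_lt_card_upperOf ht.rotate.rotate
  by_cases hi2 : (P.upperOf u c i).card = 2
  · exact descend (h.exists_above_ssubset_of_card_eq_two hP h3 ht hi2)
  by_cases hj2 : (P.upperOf u c j).card = 2
  · exact descend (h.rotate.exists_above_ssubset_of_card_eq_two hP h3 ht.rotate hj2)
  by_cases hk2 : (P.upperOf u c k).card = 2
  · exact descend (h.rotate.rotate.exists_above_ssubset_of_card_eq_two hP h3 ht.rotate.rotate hk2)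
  exact descend (h.exists_above_ssubset_of_card_eq_three hP h4 ht (by omega) (by omega) (by omega))

lemma card_upperOf_add_card_upperOf_neg (hc : ∀ v, P.IsVertex v → inner ℝ u v ≠ c) (l : Fin P.m) :
    (P.upperOf u c l).card + (P.upperOf (-u) (-c) l).card = (P.verticesOf {l}).card := by
  rw [← card_filter_add_card_filter_not (s := P.verticesOf {l}) fun v => c < inner ℝ u v, upperOf,
    upperOf]
  congr 2
  refine filter_congr fun v hv => ?_
  rw [inner_neg_left, neg_lt_neg_iff, not_lt]
  exact ⟨le_of_lt, fun h => lt_of_le_of_ne h (hc v (mem_verticesOf.1 hv).1)⟩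

/-- A simple `3`-polytope without triangles, with at most two quadrangles, at most one heptagon and
no larger facets has no three facets that meet pairwise but not all together. -/
theorem IsSimple.not_isTriad (hP : P.IsSimple) (h3 : ∀ l, (P.verticesOf {l}).card ≠ 3)
    (h4 : (univ.filter fun l => (P.verticesOf {l}).card = 4).card ≤ 2)
    (h7 : ∑ l, ((P.verticesOf {l}).card - 6) ≤ 1) : ¬P.IsTriad i j k := by
  intro ht
  have hq : ∀ {i j}, i ≠ j → (P.verticesOf {i, j}).Nonempty →
      ∃ q ∈ P.carrier, P.active q = {i, j} := by
    rintro i j hij ⟨v, hv⟩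
    obtain ⟨q, hq, ha, -⟩ := hP.exists_edge_point_gt (u := 0) (c := -1) hij hv (by simp)
    exact ⟨q, hq, ha⟩
  have hij := ht.ne
  have hjk := ht.rotate.ne
  have hki := ht.rotate.rotate.ne
  obtain ⟨q₁, hq₁, ha₁⟩ := hq hij ht.left
  obtain ⟨q₂, hq₂, ha₂⟩ := hq hjk ht.mid
  obtain ⟨q₃, hq₃, ha₃⟩ := hq hki ht.right
  -- With `u = 0` and `c = -1` the condition of lying above a given plane is void.
  obtain ⟨u, c, h, -⟩ := ht.exists_separates (u := 0) (c := -1) hP hq₁ hq₂ hq₃ ha₁ ha₂ ha₃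
    (by simp) (by simp) (by simp)
  have g := h.six_lt_curvature hP h3 h4 ht
  have g' := h.neg.six_lt_curvature hP h3 h4 ht
  have e := h.curvature_add_three hP ht
  have e' := h.neg.curvature_add_three hP ht
  have ci := card_upperOf_add_card_upperOf_neg h.ne i
  have cj := card_upperOf_add_card_upperOf_neg h.ne j
  have ck := card_upperOf_add_card_upperOf_neg h.ne k
  have hd : Disjoint (P.above u c) (P.above (-u) (-c)) := by
    rw [disjoint_left]
    intro l hl hl'
    obtain ⟨⟨v, hv⟩, hall⟩ := mem_above.1 hl
    have := (mem_above.1 hl').2 v hv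
    rw [inner_neg_left, neg_lt_neg_iff] at this
    exact this.not_gt (hall v hv)
  have hd' : Disjoint (P.above u c ∪ P.above (-u) (-c)) {i, j, k} := by
    rw [disjoint_right]
    intro l hl
    simp only [mem_insert, mem_singleton] at hl
    rw [mem_union, not_or]
    rcases hl with rfl | rfl | rfl
    exacts [⟨h.left.notMem_above, h.neg.left.notMem_above⟩,
      ⟨h.mid.notMem_above, h.neg.mid.notMem_above⟩,
      ⟨h.right.notMem_above, h.neg.right.notMem_above⟩]
  have hle := sum_le_sum_of_subset (f := fun l => (P.verticesOf {l}).card - 6)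
    (subset_univ (P.above u c ∪ P.above (-u) (-c) ∪ {i, j, k}))
  rw [sum_union hd', sum_union hd, sum_insert (by simp [hij, hki.symm]), sum_pair hjk] at hle
  -- Each side has curvature at least 7, so the triad has at least 7 + 3 + 7 + 3 = 20 vertices (with
  -- multiplicity) less the excess elsewhere, but at most 18 plus its own excess. The total excess
  -- is at most 1.
  omega

end Descent

/-! ### From common vertices to flagness and the absence of 3-belts -/

section Flag

variable {P : ConvexPolytope 3} {i j k : Fin P.m}

lemma IsSimple.p_eq (hP : P.IsSimple) (n : ℕ) :
    P.p n = (univ.filter fun l => (P.verticesOf {l}).card = n).card := by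
  rw [p, ← Set.ncard_coe_finset]
  congr 1
  ext l
  simp [hP.numEdges_eq]

lemma IsSimple.card_verticesOf_ne (hP : P.IsSimple) {n : ℕ} (h : P.p n = 0) (l : Fin P.m) :
    (P.verticesOf {l}).card ≠ n := by
  rw [hP.p_eq, card_eq_zero, filter_eq_empty_iff] at h
  exact h (mem_univ l)

lemma verticesOf_pair_nonempty (h : (P.facet i ∩ P.facet j).Nonempty) :
    (P.verticesOf {i, j}).Nonempty := by
  rw [facet_inter_facet] at h
  exact verticesOf_nonempty_of_mem_face h.some_mem

/-- Three pairwise intersecting facets have a common vertex. -/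
theorem IsSimple.exists_common_vertex (hP : P.IsSimple) (h3 : P.p 3 = 0) (h4 : P.p 4 ≤ 2)
    (h7 : P.p 7 ≤ 1) (h8 : ∀ n, 8 ≤ n → P.p n = 0) (hij : (P.facet i ∩ P.facet j).Nonempty)
    (hjk : (P.facet j ∩ P.facet k).Nonempty) (hki : (P.facet k ∩ P.facet i).Nonempty) :
    ∃ v, v ∈ P.verticesOf {i, j, k} := by
  by_contra! hno
  refine hP.not_isTriad (i := i) (j := j) (k := k) (hP.card_verticesOf_ne h3) (hP.p_eq 4 ▸ h4) ?_
    ⟨verticesOf_pair_nonempty hij, verticesOf_pair_nonempty hjk, verticesOf_pair_nonempty hki,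
      fun v hv hi hj hk => hno v (mem_verticesOf_triple.2 ⟨hv, hi, hj, hk⟩)⟩
  -- Only heptagons exceed 6, each by 1, so the total excess is at most `P.p 7`.
  rw [hP.p_eq, card_filter] at h7
  refine (sum_le_sum fun l _ => ?_).trans h7
  have : (P.verticesOf {l}).card < 8 :=
    not_le.1 fun h => hP.card_verticesOf_ne (h8 _ h) l rfl
  split_ifs <;> omega

/-- A simple `3`-polytope without triangles in which any three pairwise intersecting facets have a
common vertex is flag. -/
theorem IsSimple.isFlag (hP : P.IsSimple) (h3 : P.p 3 = 0)
    (h : ∀ i j k, (P.facet i ∩ P.facet j).Nonempty → (P.facet j ∩ P.facet k).Nonempty →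
      (P.facet k ∩ P.facet i).Nonempty → ∃ v, v ∈ P.verticesOf {i, j, k}) : P.IsFlag := by
  refine ⟨hP, fun S hS hpair => ?_⟩
  have htriple : ∀ i ∈ S, ∀ j ∈ S, ∀ k ∈ S, ∃ v, v ∈ P.verticesOf {i, j, k} :=
    fun i hi j hj k hk => h i j k (hpair i hi j hj) (hpair j hj k hk) (hpair k hk i hi)
  -- Of four pairwise meeting facets, three would form a closed chain around the fourth, making it a
  -- triangle.
  have hcard : S.toFinset.card ≤ 3 := by
    by_contra! hlt
    obtain ⟨T, hT, hT4⟩ := exists_subset_card_eq (Nat.succ_le_of_lt hlt)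
    obtain ⟨X, U, hXU, rfl, hU⟩ := card_eq_succ.1 hT4
    obtain ⟨i, j, k, hij, hik, hjk, rfl⟩ := card_eq_three.1 hU
    simp only [mem_insert, mem_singleton, not_or] at hXU
    simp only [insert_subset_iff, singleton_subset_iff, Set.mem_toFinset] at hT
    obtain ⟨a, ha⟩ := htriple X hT.1 i hT.2.1 j hT.2.2.1
    obtain ⟨b, hb⟩ := htriple X hT.1 j hT.2.2.1 k hT.2.2.2
    obtain ⟨t, ht⟩ := htriple X hT.1 k hT.2.2.2 i hT.2.1
    exact hP.card_verticesOf_ne h3 X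
      (hP.card_verticesOf_eq_three hXU.1 hXU.2.1 hXU.2.2 hij hjk hik.symm ha hb ht)
  -- Smaller sets are written as triples with repetition, which `htriple` allows.
  obtain ⟨i, j, k, hi, hj, hk, hSsub⟩ :
      ∃ i j k, i ∈ S ∧ j ∈ S ∧ k ∈ S ∧ S ⊆ ({i, j, k} : Finset (Fin P.m)) := by
    have hmem : ∀ l, l ∈ S.toFinset ↔ l ∈ S := fun l => Set.mem_toFinset
    have hpos : 0 < S.toFinset.card := card_pos.2 (by simpa using hS)
    interval_cases hc : S.toFinset.card
    · obtain ⟨i, hi⟩ := card_eq_one.1 hc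
      simp only [hi, mem_singleton] at hmem
      exact ⟨i, i, i, (hmem i).1 rfl, (hmem i).1 rfl, (hmem i).1 rfl,
        fun l hl => by simp [(hmem l).2 hl]⟩
    · obtain ⟨i, j, -, hij⟩ := card_eq_two.1 hc
      simp only [hij, mem_insert, mem_singleton] at hmem
      exact ⟨i, j, j, (hmem i).1 (by simp), (hmem j).1 (by simp), (hmem j).1 (by simp),
        fun l hl => by simpa using (hmem l).2 hl⟩
    · obtain ⟨i, j, k, -, -, -, hijk⟩ := card_eq_three.1 hc
      simp only [hijk, mem_insert, mem_singleton] at hmem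
      exact ⟨i, j, k, (hmem i).1 (by simp), (hmem j).1 (by simp), (hmem k).1 (by simp),
        fun l hl => by simpa using (hmem l).2 hl⟩
  obtain ⟨v, hv⟩ := htriple i hi j hj k hk
  rw [mem_verticesOf] at hv
  exact ⟨v, Set.mem_iInter₂.2 fun l hl =>
    mem_facet.2 ⟨hv.1.mem_carrier, hv.2 (mem_coe.1 (hSsub hl))⟩⟩

lemma not_isBelt_of_exists_common_vertex
    (h : ∀ i j k, (P.facet i ∩ P.facet j).Nonempty → (P.facet j ∩ P.facet k).Nonempty →
      (P.facet k ∩ P.facet i).Nonempty → ∃ v, v ∈ P.verticesOf {i, j, k})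
    (c : Fin 3 → Fin P.m) : ¬P.IsBelt c := by
  rintro ⟨-, hempty, hadj⟩
  obtain ⟨v, hv⟩ := h (c 0) (c 1) (c 2) ((hadj 0 1 (by decide)).2 (by decide))
    ((hadj 1 2 (by decide)).2 (by decide)) ((hadj 2 0 (by decide)).2 (by decide))
  obtain ⟨hv, h0, h1, h2⟩ := mem_verticesOf_triple.1 hv
  refine Set.notMem_empty v (hempty ▸ Set.mem_iInter.2 fun l => mem_facet.2 ⟨hv.mem_carrier, ?_⟩)
  fin_cases l
  exacts [h0, h1, h2]

lemma IsFullerene.p_eq_zero (hP : P.IsFullerene) {n : ℕ} (h5 : n ≠ 5) (h6 : n ≠ 6) :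
    P.p n = 0 := by
  rw [p, Set.ncard_eq_zero, Set.eq_empty_iff_forall_notMem]
  intro i hi
  rw [Set.mem_ofPred_eq] at hi
  have := hP.2 i
  omega

end Flag

end ConvexPolytope

theorem mainTheorem3 :
    (∀ P : ConvexPolytope 3, P.IsSimple → P.p 3 = 0 → P.p 4 ≤ 2 → P.p 7 ≤ 1 →
      (∀ k : ℕ, 8 ≤ k → P.p k = 0) →
      (¬ ∃ c : Fin 3 → Fin P.m, P.IsBelt c) ∧ P.IsFlag) ∧
    (∀ P : ConvexPolytope 3, P.IsFullerene → P.IsFlag) := by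
  have main : ∀ P : ConvexPolytope 3, P.IsSimple → P.p 3 = 0 → P.p 4 ≤ 2 → P.p 7 ≤ 1 →
      (∀ k : ℕ, 8 ≤ k → P.p k = 0) →
      (¬ ∃ c : Fin 3 → Fin P.m, P.IsBelt c) ∧ P.IsFlag := by
    intro P hP h3 h4 h7 h8
    have h := fun i j k => hP.exists_common_vertex (i := i) (j := j) (k := k) h3 h4 h7 h8
    exact ⟨fun ⟨c, hc⟩ => ConvexPolytope.not_isBelt_of_exists_common_vertex h c hc,
      hP.isFlag h3 h⟩
  refine ⟨main, fun P hP => (main P hP.1 ?_ ?_ ?_ fun k hk => ?_).2⟩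
  · exact hP.p_eq_zero (by decide) (by decide)
  · exact (hP.p_eq_zero (by decide) (by decide)).trans_le (by decide)
  · exact (hP.p_eq_zero (by decide) (by decide)).trans_le (by decide)
  · exact hP.p_eq_zero (by omega) (by omega)
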